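/- Let $\mathbb T=\mathbb R/2\pi\mathbb Z$ and let $\alpha\ge 1$. For $u\in L^2(\mathbb R\times\mathbb R\times\mathbb T)$ (variables $(t,x,y)$, complex valued) let $\widehat u\in L^2(\mathbb R\times\mathbb R\times\mathbb Z)$ denote its Fourier–Plancherel transform, i.e. the limit in $L^2$ (Lebesgue measure in $\tau,\xi$, counting measure in $n$) as $R\to\infty$ of $$\int_{-R}^{R}\int_{-R}^{R}\int_{\mathbb T}u(t,x,y)\,e^{-i(t\tau+x\xi+ny)}\,dy\,dx\,dt .$$ For $K>0$ put $$\mathcal H^+_{K}=\Big\{(\tau,\xi,n)\in\mathbb R\times\mathbb R\times\mathbb Z:\ \tfrac12K\le\big|\tau+\xi^2+|n|^{2\alpha}\big|\le 2K\Big\}.$$ Then there is a constant $C>0$, depending only on $\alpha$, such that for all real $K_1,K_2\ge 1$ and all $u_1,u_2\in L^2(\mathbb R\times\mathbb R\times\mathbb T)$ with $\operatorname{supp}\widehat{u_j}\subseteq\mathcal H^+_{K_j}$ for $j=1,2$ (that is, $\widehat{u_j}=0$ almost everywhere outside $\mathcal H^+_{K_j}$), the product $u_1u_2$ belongs to $L^2(\mathbb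 R\times\mathbb R\times\mathbb T)$ and $$\|u_1u_2\|_{L^2(\mathbb R\times\mathbb R\times\mathbb T)}\le C\,(K_1K_2)^{1/2}\,\|u_1\|_{L^2(\mathbb R\times\mathbb R\times\mathbb T)}\,\|u_2\|_{L^2(\mathbb R\times\mathbb R\times\mathbb T)}.$$ -/

import Mathlib

open MeasureTheory Filter Topology
open scoped Real

noncomputable section

namespace EllipticBilinear

instance fact_two_pi_pos : Fact ((0 : ℝ) < 2 * π) := ⟨Real.two_pi_pos⟩

/-- The torus `𝕋 = ℝ / 2πℤ`. Its `volume` is Lebesgue measure, of total mass `2π`. -/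
abbrev Torus : Type := AddCircle (2 * π)

/-- The physical space `ℝ × ℝ × 𝕋` of points `(t, x, y)`, with the product `volume`. -/
abbrev Phys : Type := ℝ × ℝ × Torus

/-- The frequency space `ℝ × ℝ × ℤ` of points `(τ, ξ, n)`. -/
abbrev Freq : Type := ℝ × ℝ × ℤ

/-- Lebesgue measure in `τ` and `ξ` times counting measure in `n`. -/
def freqMeasure : Measure Freq :=
  (volume : Measure ℝ).prod ((volume : Measure ℝ).prod (Measure.count : Measure ℤ))

/-- The conjugate character `e^{-i (t τ + x ξ + n y)}`
(on the torus of length `2π`, `fourier (-n) y = e^{-i n y}`). -/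
def conjCharacter (q : Freq) (p : Phys) : ℂ :=
  Complex.exp (-(Complex.I * ((p.1 * q.1 + p.2.1 * q.2.1 : ℝ) : ℂ))) * fourier (-q.2.2) p.2.2

theorem conjCharacter_coe (τ ξ t x y : ℝ) (n : ℤ) :
    conjCharacter (τ, ξ, n) (t, x, (y : Torus)) =
      Complex.exp (-(Complex.I * (t * τ + x * ξ + n * y))) := by
  have hpi : (π : ℂ) ≠ 0 := by exact_mod_cast Real.pi_ne_zero
  simp only [conjCharacter, fourier_coe_apply]
  rw [← Complex.exp_add]
  congr 1
  push_cast
  field_simp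
  ring

/-- The box `[-R, R] × [-R, R] × 𝕋`. -/
def box (R : ℝ) : Set Phys := {p | |p.1| ≤ R ∧ |p.2.1| ≤ R}

/-- The Fourier integral of `u` restricted to the box,
`∫_{-R}^{R} ∫_{-R}^{R} ∫_𝕋 u(t, x, y) e^{-i (t τ + x ξ + n y)} dy dx dt`.
It converges absolutely for every `u` in `L²`. -/
def truncatedFourier (u : Phys → ℂ) (R : ℝ) (q : Freq) : ℂ :=
  ∫ p in box R, u p * conjCharacter q p

/-- `v` is the Fourier(-Plancherel) transform of `u ∈ L²(ℝ × ℝ × 𝕋)`: it is the limit, in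
`L²(ℝ × ℝ × ℤ)`, of the Fourier integrals of the truncations of `u` to growing boxes. -/
def IsFourierTransform (u : Phys → ℂ) (v : Freq → ℂ) : Prop :=
  MemLp v 2 freqMeasure ∧
    Tendsto (fun R : ℝ => eLpNorm (fun q => truncatedFourier u R q - v q) 2 freqMeasure)
      atTop (𝓝 0)

/-- The Fourier transform of `u ∈ L²` is supported in the (closed) set `H`: it vanishes almost
everywhere off `H`. -/
def FourierSupportedIn (u : Phys → ℂ) (H : Set Freq) : Prop :=
  ∃ v : Freq → ℂ, IsFourierTransform u v ∧ ∀ᵐ q ∂freqMeasure, q ∉ H → v q = 0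

/-- The region `K / 2 ≤ |τ + ξ² + |n|^{2α}| ≤ 2 K`. -/
def ellipticRegion (α K : ℝ) : Set Freq :=
  {q | K / 2 ≤ |q.1 + q.2.1 ^ 2 + |(q.2.2 : ℝ)| ^ (2 * α)| ∧
    |q.1 + q.2.1 ^ 2 + |(q.2.2 : ℝ)| ^ (2 * α)| ≤ 2 * K}

end EllipticBilinear

end

noncomputable section

namespace EllipticBilinear

open scoped ENNReal ComplexConjugate FourierTransform SchwartzMap Convolution

/-! By Plancherel a product becomes a convolution of transforms. Cauchy–Schwarz on the set of `q'`
that contribute at `q`, namely `q' ∈ H₁` with `q - q' ∈ H₂`, then bounds the `L²` norm of the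
product by the square root of the largest measure of such a set (`eLpNorm_convolution_le`,
`eLpNorm_mul_le_of_freqMeasure_le`). It remains to bound that measure by a multiple of `K₁ K₂`.

For fixed `(x, m)` the admissible `τ'` fill at most an interval of length `4 min K₁ K₂`. Adding the
two constraints eliminates `τ'` and confines `(x, m)` to a shell: `2 (x - ξ/2)²` plus the pair
symbol `|m|^{2α} + |n - m|^{2α}` is within `4 max K₁ K₂` of a constant. The shell has measure `O(max
K₁ K₂)`, and `min * max = K₁ K₂`.

For the shell, write `|m|^{2α} = m² + e(m)` at integers with `e` convex (`powerExcess`). Hence the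
pair symbol grows away from `n/2` at least as fast as in the case `α = 1` (`pairSymbol_growth`). On
the half `m ≥ n/2`, let `m'` be the largest index with a non-null slice. Comparison with `m'` bounds
the slice at `m' - j` by `12 K / √(j (m' - n/2))`; the sum over `1 ≤ j ≤ m' - n/2` is `O(K)` however
large the shell is.

The transform is given only as an `L²` limit, so the Plancherel identity is proved for integrable
square-integrable functions, tensorised from `ℝ`, `𝕋` and `ℤ`, and carried over by truncation and
Fatou. -/

/-! ### Plancherel kernels and their tensor products -/

/-- A unimodular kernel whose integral operator satisfies the Plancherel identity with
constant `c` on `L¹ ∩ L²`. -/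
structure IsPlancherelKernel {X Y : Type*} [MeasurableSpace X] [MeasurableSpace Y]
    (k : X → Y → ℂ) (μ : Measure X) (ν : Measure Y) (c : ℝ) : Prop where
  measurable : Measurable (Function.uncurry k)
  norm_eq_one : ∀ x y, ‖k x y‖ = 1
  lintegral_sq : ∀ f : X → ℂ, Integrable f μ → MemLp f 2 μ →
    ∫⁻ y, ‖∫ x, f x * k x y ∂μ‖ₑ ^ 2 ∂ν = ENNReal.ofReal c * ∫⁻ x, ‖f x‖ₑ ^ 2 ∂μ

theorem lintegral_enorm_sq_lt_top_iff {X : Type*} [MeasurableSpace X] {μ : Measure X}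
    {f : X → ℂ} (hf : AEStronglyMeasurable f μ) :
    ∫⁻ x, ‖f x‖ₑ ^ 2 ∂μ < ∞ ↔ MemLp f 2 μ := by
  rw [MemLp, and_iff_right hf, eLpNorm_lt_top_iff_lintegral_rpow_enorm_lt_top (by simp) (by simp)]
  simp

theorem eLpNorm_two_sq {X : Type*} [MeasurableSpace X] (μ : Measure X) (f : X → ℂ) :
    eLpNorm f 2 μ ^ 2 = ∫⁻ x, ‖f x‖ₑ ^ 2 ∂μ := by
  have := eLpNorm_nnreal_pow_eq_lintegral (μ := μ) (f := f) (p := 2) (by simp)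
  simpa using this

namespace IsPlancherelKernel

variable {X Y : Type*} [MeasurableSpace X] [MeasurableSpace Y] {k : X → Y → ℂ} {μ : Measure X}
  {ν : Measure Y} {c : ℝ}

theorem measurable_left (hk : IsPlancherelKernel k μ ν c) (y : Y) : Measurable fun x => k x y :=
  hk.measurable.comp (measurable_id.prodMk measurable_const)

theorem integrable_mul (hk : IsPlancherelKernel k μ ν c) {f : X → ℂ} (hf : Integrable f μ)
    (y : Y) : Integrable (fun x => f x * k x y) μ :=
  hf.mul_bdd (c := 1) (hk.measurable_left y).aestronglyMeasurable
    (ae_of_all _ fun x => (hk.norm_eq_one x y).le)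

/-- Both sides depend only on the a.e. class of `f`. A strongly measurable representative makes
slices and partial integrals of `f` measurable. -/
theorem of_stronglyMeasurable (hm : Measurable (Function.uncurry k)) (h1 : ∀ x y, ‖k x y‖ = 1)
    (h : ∀ f : X → ℂ, StronglyMeasurable f → Integrable f μ → MemLp f 2 μ →
      ∫⁻ y, ‖∫ x, f x * k x y ∂μ‖ₑ ^ 2 ∂ν = ENNReal.ofReal c * ∫⁻ x, ‖f x‖ₑ ^ 2 ∂μ) :
    IsPlancherelKernel k μ ν c := by
  refine ⟨hm, h1, fun f hf hf2 => ?_⟩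
  have hae := hf.1.ae_eq_mk
  have := h (hf.1.mk f) hf.1.stronglyMeasurable_mk (hf.congr hae) (hf2.ae_eq hae)
  rw [lintegral_congr_ae (g := fun x => ‖hf.1.mk f x‖ₑ ^ 2)
    (hae.mono fun x hx => by simp only [hx]), ← this]
  refine lintegral_congr fun y => ?_
  rw [integral_congr_ae (g := fun x => hf.1.mk f x * k x y) (hae.mono fun x hx => by simp only [hx])]

theorem conjugate (hk : IsPlancherelKernel k μ ν c) :
    IsPlancherelKernel (fun x y => conj (k x y)) μ ν c := by
  refine ⟨Complex.continuous_conj.measurable.comp hk.measurable,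
    fun x y => by rw [RCLike.norm_conj, hk.norm_eq_one], fun f hf hf2 => ?_⟩
  have hi : Integrable (fun x => conj (f x)) μ :=
    (integrable_norm_iff (Complex.continuous_conj.comp_aestronglyMeasurable hf.1)).1
      (by simpa using hf.norm)
  have h2 : MemLp (fun x => conj (f x)) 2 μ :=
    hf2.of_le hi.1 (ae_of_all _ fun x => by simp)
  have key := hk.lintegral_sq _ hi h2
  have e : ∀ z : ℂ, ‖conj z‖ₑ = ‖z‖ₑ := fun z => by
    rw [← ofReal_norm, ← ofReal_norm, RCLike.norm_conj]
  simp only [e] at key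
  rw [← key]
  refine lintegral_congr fun y => ?_
  rw [← e, ← integral_conj]
  simp

/-- A tensor product of Plancherel kernels is a Plancherel kernel. -/
theorem prod {X' Y' : Type*} [MeasurableSpace X'] [MeasurableSpace Y'] {k' : X' → Y' → ℂ}
    {μ' : Measure X'} {ν' : Measure Y'} {c' : ℝ} [SFinite μ] [SFinite ν] [SFinite μ'] [SFinite ν']
    (hk : IsPlancherelKernel k μ ν c) (hk' : IsPlancherelKernel k' μ' ν' c') (hc : 0 ≤ c) :
    IsPlancherelKernel (fun (p : X × X') (q : Y × Y') => k p.1 q.1 * k' p.2 q.2)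
      (μ.prod μ') (ν.prod ν') (c * c') := by
  refine of_stronglyMeasurable ?_ (fun p q => by simp [hk.norm_eq_one, hk'.norm_eq_one]) ?_
  · have h1 := hk.measurable.comp (g := Function.uncurry k)
      (f := fun z : (X × X') × (Y × Y') => (z.1.1, z.2.1)) (by fun_prop)
    have h2 := hk'.measurable.comp (g := Function.uncurry k')
      (f := fun z : (X × X') × (Y × Y') => (z.1.2, z.2.2)) (by fun_prop)
    exact h1.mul h2
  intro f hfm hf hf2
  -- The partial transform in the second variable: Plancherel on slices gives its norm, and
  -- Plancherel in the first variable finishes.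
  set g : X × Y' → ℂ := fun z => ∫ x', f (z.1, x') * k' x' z.2 ∂μ' with hg
  have hFm : StronglyMeasurable fun w : (X × Y') × X' => f (w.1.1, w.2) * k' w.2 w.1.2 := by
    refine (hfm.comp_measurable (by fun_prop)).mul ?_
    exact (hk'.measurable.comp (g := Function.uncurry k')
      (f := fun w : (X × Y') × X' => (w.2, w.1.2)) (by fun_prop)).stronglyMeasurable
  have hgm : StronglyMeasurable g := hFm.integral_prod_right'
  have hfin : ∫⁻ z, ‖f z‖ₑ ^ 2 ∂(μ.prod μ') < ∞ :=
    (lintegral_enorm_sq_lt_top_iff hf.1).2 hf2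
  have hfm2 : Measurable fun z => ‖f z‖ₑ ^ 2 := by
    have := hfm.measurable; fun_prop
  have hgm2 : Measurable fun z => ‖g z‖ₑ ^ 2 := by
    have := hgm.measurable; fun_prop
  have hslice : ∀ᵐ x ∂μ, ∫⁻ y', ‖g (x, y')‖ₑ ^ 2 ∂ν' =
      ENNReal.ofReal c' * ∫⁻ x', ‖f (x, x')‖ₑ ^ 2 ∂μ' := by
    have hfin' : ∀ᵐ x ∂μ, ∫⁻ x', ‖f (x, x')‖ₑ ^ 2 ∂μ' < ∞ := by
      refine ae_lt_top hfm2.lintegral_prod_right' ?_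
      rw [← lintegral_prod _ hfm2.aemeasurable]
      exact hfin.ne
    filter_upwards [hf.prod_right_ae, hfin'] with x hx hx2
    exact hk'.lintegral_sq _ hx ((lintegral_enorm_sq_lt_top_iff hx.1).1 hx2)
  have hgint : ∫⁻ z, ‖g z‖ₑ ^ 2 ∂(μ.prod ν') =
      ENNReal.ofReal c' * ∫⁻ z, ‖f z‖ₑ ^ 2 ∂(μ.prod μ') := by
    rw [lintegral_prod _ hgm2.aemeasurable, lintegral_prod _ hfm2.aemeasurable,
      ← lintegral_const_mul _ hfm2.lintegral_prod_right']
    exact lintegral_congr_ae hslice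
  have hFint : ∀ y', Integrable (fun z : X × X' => f z * k' z.2 y') (μ.prod μ') := fun y' =>
    hf.mul_bdd (c := 1) ((hk'.measurable_left y').comp measurable_snd).aestronglyMeasurable
      (ae_of_all _ fun x => (hk'.norm_eq_one x.2 y').le)
  have hgslice : ∀ᵐ y' ∂ν', ∫⁻ y, ‖∫ x, g (x, y') * k x y ∂μ‖ₑ ^ 2 ∂ν =
      ENNReal.ofReal c * ∫⁻ x, ‖g (x, y')‖ₑ ^ 2 ∂μ := by
    have hfin' : ∀ᵐ y' ∂ν', ∫⁻ x, ‖g (x, y')‖ₑ ^ 2 ∂μ < ∞ := by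
      refine ae_lt_top hgm2.lintegral_prod_left' ?_
      rw [← lintegral_prod_symm _ hgm2.aemeasurable, hgint]
      exact ENNReal.mul_ne_top ENNReal.ofReal_ne_top hfin.ne
    filter_upwards [hfin'] with y' hy
    -- Integrability of this slice holds for every `y'`, since the kernel is bounded; only square
    -- integrability needs the exceptional null set.
    have hi : Integrable (fun x => g (x, y')) μ := (hFint y').integral_prod_left
    exact hk.lintegral_sq _ hi ((lintegral_enorm_sq_lt_top_iff hi.1).1 hy)
  have hop : ∀ q : Y × Y', ∫ p, f p * (k p.1 q.1 * k' p.2 q.2) ∂(μ.prod μ') =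
      ∫ x, g (x, q.2) * k x q.1 ∂μ := by
    intro q
    have hi : Integrable (fun p : X × X' => f p * (k p.1 q.1 * k' p.2 q.2)) (μ.prod μ') := by
      have := (hFint q.2).mul_bdd (c := 1) (g := fun p : X × X' => k p.1 q.1)
        ((hk.measurable_left q.1).comp measurable_fst).aestronglyMeasurable
        (ae_of_all _ fun x => (hk.norm_eq_one x.1 q.1).le)
      exact this.congr (ae_of_all _ fun p => by simp only; ring)
    rw [integral_prod _ hi]
    refine integral_congr_ae (ae_of_all _ fun x => ?_)
    simp only [hg]
    rw [← integral_mul_const]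
    refine integral_congr_ae (ae_of_all _ fun x' => ?_)
    simp only
    ring
  have hopm : Measurable fun q : Y × Y' => ‖∫ x, g (x, q.2) * k x q.1 ∂μ‖ₑ ^ 2 := by
    have : StronglyMeasurable fun w : (Y × Y') × X => g (w.2, w.1.2) * k w.2 w.1.1 := by
      refine (hgm.comp_measurable (by fun_prop)).mul ?_
      exact (hk.measurable.comp (g := Function.uncurry k)
        (f := fun w : (Y × Y') × X => (w.2, w.1.1)) (by fun_prop)).stronglyMeasurable
    have := (this.integral_prod_right' (ν := μ)).measurable
    fun_prop
  simp only [hop]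
  rw [lintegral_prod_symm _ hopm.aemeasurable, lintegral_congr_ae hgslice,
    lintegral_const_mul _ hgm2.lintegral_prod_left', ← lintegral_prod_symm _ hgm2.aemeasurable,
    hgint, ENNReal.ofReal_mul hc, mul_assoc]

end IsPlancherelKernel

/-! ### Plancherel on the line, the torus and the integers -/

/-- On `L¹ ∩ L²` the Fourier integral is a representative of the `L²` Fourier transform. -/
theorem fourier_toLp_ae_eq {f : ℝ → ℂ} (hf : Integrable f) (hf2 : MemLp f 2) :
    (𝓕 (hf2.toLp f) : Lp ℂ 2 (volume : Measure ℝ)) =ᵐ[volume] 𝓕 f := by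
  have hcont : Continuous (𝓕 f) :=
    VectorFourier.fourierIntegral_continuous Real.continuous_fourierChar
      (by exact continuous_inner) hf
  -- Both functions are tested against smooth compactly supported `g`: the `L²` transform through
  -- its tempered distribution, the integral through the multiplication formula.
  refine ae_eq_of_integral_contDiff_smul_eq
    ((Lp.memLp _).locallyIntegrable (by norm_num)) hcont.locallyIntegrable fun g hg hgc => ?_
  have hg' : ContDiff ℝ (⊤ : ℕ∞) (fun x => (g x : ℂ)) := Complex.ofRealCLM.contDiff.comp hg
  have hgc' : HasCompactSupport (fun x => (g x : ℂ)) :=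
    hgc.comp_left (g := fun r : ℝ => (r : ℂ)) (by simp)
  set G : 𝓢(ℝ, ℂ) := hgc'.toSchwartzMap hg' with hG
  have hGx : ∀ x, G x = (g x : ℂ) := fun x => rfl
  have h1 := congrArg (fun T => T G) (Lp.fourier_toTemperedDistribution_eq (hf2.toLp f))
  simp only [TemperedDistribution.fourier_apply] at h1
  rw [Lp.toTemperedDistribution_apply, Lp.toTemperedDistribution_apply] at h1
  have h2 : ∫ x, 𝓕 f x • G x = ∫ x, f x • 𝓕 (⇑G) x :=
    VectorFourier.integral_fourierIntegral_smul_eq_flip (L := innerₗ ℝ)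
      Real.continuous_fourierChar (by exact continuous_inner) hf G.integrable |>.trans (by
        rw [flip_innerₗ]; rfl)
  calc ∫ x, g x • (𝓕 (hf2.toLp f) : Lp ℂ 2 (volume : Measure ℝ)) x
      = ∫ x, G x • (𝓕 (hf2.toLp f) : Lp ℂ 2 (volume : Measure ℝ)) x := by
        simp [hGx, Complex.real_smul]
    _ = ∫ x, (𝓕 G) x • (hf2.toLp f) x := h1.symm
    _ = ∫ x, f x • 𝓕 (⇑G) x := by
        refine integral_congr_ae ?_
        filter_upwards [hf2.coeFn_toLp] with x hx
        rw [hx, SchwartzMap.fourier_coe, smul_eq_mul, smul_eq_mul, mul_comm]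
    _ = ∫ x, 𝓕 f x • G x := h2.symm
    _ = ∫ x, g x • 𝓕 f x := by
        refine integral_congr_ae (ae_of_all _ fun x => ?_)
        simp [hGx, Complex.real_smul, mul_comm]

theorem lintegral_enorm_fourier_sq {f : ℝ → ℂ} (hf : Integrable f) (hf2 : MemLp f 2) :
    ∫⁻ s, ‖𝓕 f s‖ₑ ^ 2 = ∫⁻ x, ‖f x‖ₑ ^ 2 := by
  rw [← eLpNorm_two_sq, ← eLpNorm_two_sq, ← eLpNorm_congr_ae (fourier_toLp_ae_eq hf hf2),
    ← eLpNorm_congr_ae hf2.coeFn_toLp, ← Lp.enorm_def, ← Lp.enorm_def, ← ofReal_norm,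
    ← ofReal_norm, Lp.norm_fourier_eq]

/-- Rescaling the frequency by `(2π)⁻¹` gives the transform `𝓕` with character `e^{-2πi t s}`, which
is isometric; the Jacobian is the constant `2π`. -/
theorem isPlancherelKernel_real :
    IsPlancherelKernel (fun t τ : ℝ => Complex.exp (-(Complex.I * ((t * τ : ℝ) : ℂ))))
      volume volume (2 * π) := by
  refine .of_stronglyMeasurable (by fun_prop) (fun t τ => ?_) fun f _ hf hf2 => ?_
  · rw [Complex.norm_exp]
    simp
  · have hpi : (2 * π) ≠ 0 := Real.two_pi_pos.ne'
    have h : ∀ τ : ℝ, ∫ t, f t * Complex.exp (-(Complex.I * ((t * τ : ℝ) : ℂ))) =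
        𝓕 f ((2 * π)⁻¹ * τ) := fun τ => by
      rw [Real.fourier_real_eq_integral_exp_smul]
      refine integral_congr_ae (ae_of_all _ fun t => ?_)
      simp only [smul_eq_mul]
      rw [mul_comm]
      congr 2
      have hpi' : (π : ℂ) ≠ 0 := by exact_mod_cast Real.pi_ne_zero
      push_cast
      field_simp
    have hcont : Continuous (𝓕 f) :=
      VectorFourier.fourierIntegral_continuous Real.continuous_fourierChar
        (by exact continuous_inner) hf
    have hm : Measurable fun s => ‖𝓕 f s‖ₑ ^ 2 := by
      have := hcont.measurable; fun_prop
    simp only [h]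
    rw [← lintegral_map (μ := volume) hm (measurable_const_mul _),
      Real.map_volume_mul_left (inv_ne_zero hpi), lintegral_smul_measure,
      lintegral_enorm_fourier_sq hf hf2, inv_inv, abs_of_pos Real.two_pi_pos, smul_eq_mul]

theorem measurable_fourier_neg : Measurable (Function.uncurry fun (n : ℤ) (y : Torus) =>
    fourier (-n) y) :=
  measurable_from_prod_countable_right fun n => (map_continuous (fourier (-n))).measurable

theorem lintegral_torus (h : Torus → ℝ≥0∞) :
    ∫⁻ y, h y = ENNReal.ofReal (2 * π) * ∫⁻ y, h y ∂AddCircle.haarAddCircle := by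
  rw [AddCircle.volume_eq_smul_haarAddCircle, lintegral_smul_measure, smul_eq_mul]

theorem integral_torus (h : Torus → ℂ) :
    ∫ y, h y = (2 * π : ℝ) * ∫ y, h y ∂AddCircle.haarAddCircle := by
  rw [AddCircle.volume_eq_smul_haarAddCircle, integral_smul_measure,
    ENNReal.toReal_ofReal Real.two_pi_pos.le, Complex.real_smul]

theorem tsum_enorm_fourierCoeff_sq {f : Torus → ℂ} (hf : MemLp f 2 AddCircle.haarAddCircle) :
    ∑' n : ℤ, ‖fourierCoeff f n‖ₑ ^ 2 = ∫⁻ y, ‖f y‖ₑ ^ 2 ∂AddCircle.haarAddCircle := by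
  have h := hasSum_sq_fourierCoeff (hf.toLp f)
  have hae := hf.coeFn_toLp
  have e : ∀ z : ℂ, ‖z‖ₑ ^ 2 = ENNReal.ofReal (‖z‖ ^ 2) := fun z => by
    rw [ENNReal.ofReal_pow (norm_nonneg _), ofReal_norm]
  rw [fourierCoeff_congr_ae hae] at h
  rw [integral_congr_ae (g := fun y => ‖f y‖ ^ 2) (hae.mono fun y hy => by simp only [hy])] at h
  simp only [e]
  rw [← ENNReal.ofReal_tsum_of_nonneg (fun _ => by positivity) h.summable, h.tsum_eq,
    ofReal_integral_eq_lintegral_ofReal ((memLp_two_iff_integrable_sq_norm hf.1).1 hf)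
      (ae_of_all _ fun _ => by positivity)]

/-- Parseval for Haar probability measure: the squared integral carries `(2π)²`, of which one factor
turns Haar measure back into `volume`. -/
theorem isPlancherelKernel_torus :
    IsPlancherelKernel (fun (y : Torus) (n : ℤ) => fourier (-n) y)
      volume Measure.count (2 * π) := by
  refine .of_stronglyMeasurable (measurable_fourier_neg.comp measurable_swap)
    (fun y n => ?_) fun f _ hf hf2 => ?_
  · rw [fourier_apply, Circle.norm_coe]
  · have hi : ∀ n : ℤ, ∫ y, f y * fourier (-n) y = (2 * π : ℝ) * fourierCoeff f n := fun n => by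
      rw [integral_torus, fourierCoeff]
      simp only [smul_eq_mul, mul_comm (f _)]
    have h2 : ‖((2 * π : ℝ) : ℂ)‖ₑ = ENNReal.ofReal (2 * π) := by
      rw [← ofReal_norm, Complex.norm_real, Real.norm_of_nonneg Real.two_pi_pos.le]
    simp only [hi, enorm_mul, mul_pow, h2]
    rw [lintegral_count, ENNReal.tsum_mul_left, tsum_enorm_fourierCoeff_sq hf2.haarAddCircle,
      lintegral_torus, ← mul_assoc, ← sq]

/-- A summable sequence is the sequence of Fourier coefficients of its uniformly convergent series,
so Parseval applies in the reverse direction. -/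
theorem isPlancherelKernel_int :
    IsPlancherelKernel (fun (n : ℤ) (y : Torus) => fourier (-n) y)
      Measure.count volume (2 * π) := by
  suffices h : IsPlancherelKernel (fun (n : ℤ) (y : Torus) => fourier n y)
      Measure.count volume (2 * π) by
    simpa only [← fourier_neg] using h.conjugate
  refine .of_stronglyMeasurable ?_ (fun n y => ?_) fun f _ hf hf2 => ?_
  · exact measurable_from_prod_countable_right fun n => (map_continuous (fourier n)).measurable
  · rw [fourier_apply, Circle.norm_coe]
  · have hsum : Summable f := by simpa using (integrable_count_iff.1 hf).of_norm
    have hS : Summable fun n => f n • (fourier n : C(Torus, ℂ)) := by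
      refine Summable.of_norm (hsum.norm.congr fun n => ?_)
      rw [norm_smul, fourier_norm, mul_one]
    set F : C(Torus, ℂ) := ∑' n, f n • fourier n with hF
    have hFy : ∀ y : Torus, ∫ n, f n * fourier n y ∂Measure.count = F y := fun y => by
      have h1 : Integrable (fun n => f n * fourier n y) Measure.count := by
        rw [integrable_count_iff]
        refine hsum.norm.congr fun n => ?_
        rw [norm_mul, fourier_apply, Circle.norm_coe, mul_one]
      have h2 := ((ContinuousMap.evalCLM ℂ y).hasSum hS.hasSum).tsum_eq
      simp only [ContinuousMap.evalCLM_apply, ContinuousMap.smul_apply, smul_eq_mul] at h2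
      rw [← hF] at h2
      rw [← h2, integral_countable h1]
      simp
    have hL := (ContinuousMap.toLp (E := ℂ) 2 AddCircle.haarAddCircle ℂ).hasSum hS.hasSum
    have hcoef : ∀ m, fourierCoeff F m = f m := fun m => by
      -- The coefficient is a continuous functional on `L²`, so it may be taken term by term;
      -- orthonormality leaves only the term `n = m`.
      have h3 := (innerSL ℂ (fourierBasis (T := 2 * π) m)).hasSum hL
      rw [← fourierCoeff_toLp, ← fourierBasis_repr, HilbertBasis.repr_apply_apply]
      refine HasSum.unique h3 ?_
      convert! hasSum_ite_eq m (f m) using 2 with n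
      have : (ContinuousMap.toLp (E := ℂ) 2 AddCircle.haarAddCircle ℂ) (f n • fourier n) =
          f n • fourierBasis (T := 2 * π) n := by
        rw [map_smul, coe_fourierBasis]
      rw [this, map_smul, innerSL_apply_apply,
        orthonormal_iff_ite.1 (fourierBasis (T := 2 * π)).orthonormal]
      rcases eq_or_ne n m with rfl | h
      · rw [if_pos rfl, if_pos rfl, smul_eq_mul, mul_one]
      · rw [if_neg h.symm, if_neg h, smul_zero]
    simp only [hFy]
    rw [lintegral_torus, ← tsum_enorm_fourierCoeff_sq, lintegral_count]
    · simp only [hcoef]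
    · exact (map_continuous F).memLp_of_hasCompactSupport (HasCompactSupport.of_compactSpace _)

/-! ### The transform on `ℝ × ℝ × 𝕋` and its adjoint -/

instance : SFinite freqMeasure := by unfold freqMeasure; infer_instance

theorem conjCharacter_eq (p : Phys) (q : Freq) : conjCharacter q p =
    Complex.exp (-(Complex.I * ((p.1 * q.1 : ℝ) : ℂ))) *
      (Complex.exp (-(Complex.I * ((p.2.1 * q.2.1 : ℝ) : ℂ))) * fourier (-q.2.2) p.2.2) := by
  rw [conjCharacter, ← mul_assoc, ← Complex.exp_add]
  congr 2
  push_cast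
  ring

/-- The Plancherel constant `(2π)³` of the unnormalised transform on `ℝ × ℝ × 𝕋`. -/
def plancherelConst : ℝ := 2 * π * (2 * π * (2 * π))

theorem isPlancherelKernel_phys :
    IsPlancherelKernel (fun (p : Phys) (q : Freq) => conjCharacter q p)
      volume freqMeasure plancherelConst := by
  simp only [conjCharacter_eq]
  exact isPlancherelKernel_real.prod (isPlancherelKernel_real.prod isPlancherelKernel_torus
    Real.two_pi_pos.le) Real.two_pi_pos.le

theorem isPlancherelKernel_freq :
    IsPlancherelKernel (fun (q : Freq) (p : Phys) => conj (conjCharacter q p))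
      freqMeasure volume plancherelConst := by
  refine IsPlancherelKernel.conjugate ?_
  have hr := isPlancherelKernel_real
  have := hr.prod (hr.prod isPlancherelKernel_int Real.two_pi_pos.le) Real.two_pi_pos.le
  have e : conjCharacter = fun (q : Freq) (p : Phys) =>
      Complex.exp (-(Complex.I * ((q.1 * p.1 : ℝ) : ℂ))) *
        (Complex.exp (-(Complex.I * ((q.2.1 * p.2.1 : ℝ) : ℂ))) * fourier (-q.2.2) p.2.2) := by
    ext q p
    rw [conjCharacter_eq, mul_comm q.1, mul_comm q.2.1]
  rw [e]
  exact this

namespace IsPlancherelKernel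

variable {X Y : Type*} [MeasurableSpace X] [MeasurableSpace Y] {k : X → Y → ℂ} {μ : Measure X}
  {ν : Measure Y} {c : ℝ}

theorem stronglyMeasurable_integral [SFinite μ] (hk : IsPlancherelKernel k μ ν c) {f : X → ℂ}
    (hf : Integrable f μ) : StronglyMeasurable fun y => ∫ x, f x * k x y ∂μ := by
  have h : (fun y => ∫ x, f x * k x y ∂μ) = fun y => ∫ x, hf.1.mk f x * k x y ∂μ := by
    ext y
    exact integral_congr_ae (hf.1.ae_eq_mk.mono fun x hx => by simp only [← hx])
  rw [h]
  have : StronglyMeasurable fun w : Y × X => hf.1.mk f w.2 * k w.2 w.1 := by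
    refine (hf.1.stronglyMeasurable_mk.comp_measurable measurable_snd).mul ?_
    exact (hk.measurable.comp measurable_swap).stronglyMeasurable
  exact this.integral_prod_right'

theorem eLpNorm_integral (hk : IsPlancherelKernel k μ ν c) {f : X → ℂ}
    (hf : Integrable f μ) (hf2 : MemLp f 2 μ) :
    eLpNorm (fun y => ∫ x, f x * k x y ∂μ) 2 ν = ENNReal.ofReal (√c) * eLpNorm f 2 μ := by
  rcases le_total 0 c with hc | hc
  · rw [← (ENNReal.pow_right_strictMono two_ne_zero).injective.eq_iff, eLpNorm_two_sq, hk.lintegral_sq f hf hf2, mul_pow,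
      ← ENNReal.ofReal_pow (Real.sqrt_nonneg c), Real.sq_sqrt hc, eLpNorm_two_sq]
  · rw [← (ENNReal.pow_right_strictMono two_ne_zero).injective.eq_iff, eLpNorm_two_sq, hk.lintegral_sq f hf hf2,
      Real.sqrt_eq_zero_of_nonpos hc, ENNReal.ofReal_of_nonpos hc]
    simp

theorem memLp_integral [SFinite μ] (hk : IsPlancherelKernel k μ ν c) {f : X → ℂ}
    (hf : Integrable f μ) (hf2 : MemLp f 2 μ) : MemLp (fun y => ∫ x, f x * k x y ∂μ) 2 ν :=
  ⟨(hk.stronglyMeasurable_integral hf).aestronglyMeasurable, by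
    rw [hk.eLpNorm_integral hf hf2]
    exact ENNReal.mul_lt_top ENNReal.ofReal_lt_top hf2.2⟩

/-- Fubini, legitimate because both functions are integrable and the kernel is bounded. -/
theorem integral_conj_mul_integral [SFinite μ] [SFinite ν] (hk : IsPlancherelKernel k μ ν c)
    {f : X → ℂ} {w : Y → ℂ} (hf : Integrable f μ) (hw : Integrable w ν) :
    ∫ x, f x * conj (∫ y, w y * conj (k x y) ∂ν) ∂μ =
      ∫ y, (∫ x, f x * k x y ∂μ) * conj (w y) ∂ν := by
  have hcw : Integrable (fun y => conj (w y)) ν :=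
    (integrable_norm_iff (Complex.continuous_conj.comp_aestronglyMeasurable hw.1)).1
      (by simpa using hw.norm)
  have hint : Integrable (fun z : X × Y => f z.1 * conj (w z.2) * k z.1 z.2) (μ.prod ν) :=
    (hf.mul_prod hcw).mul_bdd (c := 1) hk.measurable.aestronglyMeasurable
      (ae_of_all _ fun z => (hk.norm_eq_one z.1 z.2).le)
  calc ∫ x, f x * conj (∫ y, w y * conj (k x y) ∂ν) ∂μ
      = ∫ x, ∫ y, f x * conj (w y) * k x y ∂ν ∂μ := by
        refine integral_congr_ae (ae_of_all _ fun x => ?_)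
        simp only
        rw [← integral_conj, ← integral_const_mul]
        simp only [map_mul, Complex.conj_conj, mul_assoc]
    _ = ∫ y, ∫ x, f x * conj (w y) * k x y ∂μ ∂ν := integral_integral_swap hint
    _ = ∫ y, (∫ x, f x * k x y ∂μ) * conj (w y) ∂ν := by
        refine integral_congr_ae (ae_of_all _ fun y => ?_)
        simp only
        rw [← integral_mul_const]
        refine integral_congr_ae (ae_of_all _ fun x => ?_)
        simp only
        ring

/-- A Plancherel kernel and its adjoint are inverse to each other, up to the constant `c`. -/
theorem eLpNorm_adjoint_sub [SFinite μ] [SFinite ν] (hk : IsPlancherelKernel k μ ν c)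
    (hk' : IsPlancherelKernel (fun y x => conj (k x y)) ν μ c) (hc : 0 ≤ c)
    {f : X → ℂ} {w : Y → ℂ} (hf : Integrable f μ) (hf2 : MemLp f 2 μ) (hw : Integrable w ν)
    (hw2 : MemLp w 2 ν) :
    eLpNorm (fun x => (∫ y, w y * conj (k x y) ∂ν) - c * f x) 2 μ =
      ENNReal.ofReal (√c) * eLpNorm (fun y => w y - ∫ x, f x * k x y ∂μ) 2 ν := by
  have hA := hk'.memLp_integral hw hw2
  have hG := hk.memLp_integral hf hf2
  set A := hA.toLp
  set G := hG.toLp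
  set B := hf2.toLp
  set W := hw2.toLp
  have hAW : ‖A‖ = √c * ‖W‖ := by
    rw [Lp.norm_toLp, Lp.norm_toLp, hk'.eLpNorm_integral hw hw2, ENNReal.toReal_mul,
      ENNReal.toReal_ofReal (Real.sqrt_nonneg c)]
  have hGB : ‖G‖ = √c * ‖B‖ := by
    rw [Lp.norm_toLp, Lp.norm_toLp, hk.eLpNorm_integral hf hf2, ENNReal.toReal_mul,
      ENNReal.toReal_ofReal (Real.sqrt_nonneg c)]
  have hin : inner ℂ A B = inner ℂ W G := by
    rw [L2.inner_def, L2.inner_def]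
    have h1 : ∫ x, inner ℂ (A x) (B x) ∂μ =
        ∫ x, f x * conj (∫ y, w y * conj (k x y) ∂ν) ∂μ := by
      refine integral_congr_ae ?_
      filter_upwards [hA.coeFn_toLp, hf2.coeFn_toLp] with x h1 h2
      rw [h1, h2, RCLike.inner_apply]
    have h2 : ∫ y, inner ℂ (W y) (G y) ∂ν =
        ∫ y, (∫ x, f x * k x y ∂μ) * conj (w y) ∂ν := by
      refine integral_congr_ae ?_
      filter_upwards [hG.coeFn_toLp, hw2.coeFn_toLp] with x h1 h2
      rw [h1, h2, RCLike.inner_apply]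
    rw [h1, h2, hk.integral_conj_mul_integral hf hw]
  -- Expanding both squares: `‖A‖² = c ‖W‖²`, `c² ‖B‖² = c ‖G‖²`, and the cross terms agree by
  -- adjointness.
  have key : ‖A - (c : ℂ) • B‖ = √c * ‖W - G‖ := by
    rw [← pow_left_inj₀ (norm_nonneg _) (by positivity) two_ne_zero, mul_pow, Real.sq_sqrt hc,
      @norm_sub_sq ℂ, @norm_sub_sq ℂ, inner_smul_right, norm_smul, hin, hAW, hGB, mul_pow,
      mul_pow, mul_pow, Real.sq_sqrt hc, Complex.norm_real, Real.norm_of_nonneg hc]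
    simp only [RCLike.re_to_complex, Complex.re_ofReal_mul]
    ring
  have e1 : A - (c : ℂ) • B = (hA.sub (hf2.const_smul (c : ℂ))).toLp := by
    rw [MemLp.toLp_sub hA (hf2.const_smul (c : ℂ)), MemLp.toLp_const_smul]
  have e2 : W - G = (hw2.sub hG).toLp := by rw [MemLp.toLp_sub]
  have key' := congrArg ENNReal.ofReal key
  rw [e1, e2, ENNReal.ofReal_mul (Real.sqrt_nonneg c), Lp.norm_toLp, Lp.norm_toLp,
    ENNReal.ofReal_toReal (hA.sub (hf2.const_smul (c : ℂ))).2.ne,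
    ENNReal.ofReal_toReal (hw2.sub hG).2.ne] at key'
  exact key'

end IsPlancherelKernel

/-! ### Truncation and approximate inversion in `L²` -/

theorem tendsto_eLpNorm_indicator_sub {X ι : Type*} [MeasurableSpace X] {μ : Measure X}
    {l : Filter ι} [l.IsCountablyGenerated] {f : X → ℂ} (hf : MemLp f 2 μ) {S : ι → Set X}
    (hS : ∀ i, MeasurableSet (S i)) (hSl : ∀ x, ∀ᶠ i in l, x ∈ S i) :
    Tendsto (fun i => eLpNorm (fun x => (S i).indicator f x - f x) 2 μ) l (𝓝 0) := by
  have h0 : Tendsto (fun i => ∫⁻ x, ‖(S i).indicator f x - f x‖ₑ ^ 2 ∂μ) l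
      (𝓝 (∫⁻ _, 0 ∂μ)) := by
    refine tendsto_lintegral_filter_of_dominated_convergence' (fun x => ‖f x‖ₑ ^ 2)
      (Eventually.of_forall fun i => ?_) (Eventually.of_forall fun i => ae_of_all _ fun x => ?_)
      ((lintegral_enorm_sq_lt_top_iff hf.1).2 hf).ne (ae_of_all _ fun x => ?_)
    · exact ((hf.1.indicator (hS i)).sub hf.1).enorm.pow_const 2
    · by_cases hx : x ∈ S i <;> simp [hx]
    · refine tendsto_const_nhds.congr' ?_
      filter_upwards [hSl x] with i hi
      simp [hi]
  have h1 := ((ENNReal.continuous_rpow_const (y := (1 / 2 : ℝ))).tendsto _).comp h0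
  simp only [lintegral_zero] at h1
  rw [ENNReal.zero_rpow_of_pos (by norm_num)] at h1
  refine h1.congr fun i => ?_
  rw [Function.comp_apply, ← eLpNorm_two_sq, ← ENNReal.rpow_natCast, ← ENNReal.rpow_mul]
  norm_num

/-- The unnormalised Fourier integral on the physical side. -/
def fourierIntegral (u : Phys → ℂ) (q : Freq) : ℂ := ∫ p, u p * conjCharacter q p

/-- The unnormalised inverse Fourier integral. -/
def inverseIntegral (w : Freq → ℂ) (p : Phys) : ℂ :=
  ∫ q, w q * conj (conjCharacter q p) ∂freqMeasure

theorem plancherelConst_pos : 0 < plancherelConst := by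
  unfold plancherelConst; positivity

theorem isCompact_box (R : ℝ) : IsCompact (box R) := by
  have : box R = Set.Icc (-R) R ×ˢ (Set.Icc (-R) R ×ˢ Set.univ) := by
    ext p
    simp [box, abs_le]
  rw [this]
  exact isCompact_Icc.prod (isCompact_Icc.prod isCompact_univ)

theorem measurableSet_box (R : ℝ) : MeasurableSet (box R) := (isCompact_box R).measurableSet

theorem truncatedFourier_eq (u : Phys → ℂ) (R : ℝ) :
    truncatedFourier u R = fourierIntegral ((box R).indicator u) := by
  ext q
  rw [truncatedFourier, fourierIntegral, ← integral_indicator (measurableSet_box R)]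
  simp only [Set.indicator_mul_left]

theorem integrable_indicator_box {u : Phys → ℂ} (hu : MemLp u 2) (R : ℝ) :
    Integrable ((box R).indicator u) := by
  rw [integrable_indicator_iff (measurableSet_box R)]
  have : IsFiniteMeasure ((volume : Measure Phys).restrict (box R)) :=
    ⟨by simpa using (isCompact_box R).measure_lt_top⟩
  exact (hu.restrict (box R)).integrable (by norm_num)

theorem tendsto_eLpNorm_box {u : Phys → ℂ} (hu : MemLp u 2) :
    Tendsto (fun R => eLpNorm (fun p => (box R).indicator u p - u p) 2) atTop (𝓝 0) := by
  refine tendsto_eLpNorm_indicator_sub hu measurableSet_box fun p => ?_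
  filter_upwards [eventually_ge_atTop |p.1|, eventually_ge_atTop |p.2.1|] with R h1 h2
  exact ⟨h1, h2⟩

theorem memLp_fourierIntegral {u : Phys → ℂ} (hu : Integrable u) (hu2 : MemLp u 2) :
    MemLp (fourierIntegral u) 2 freqMeasure :=
  isPlancherelKernel_phys.memLp_integral hu hu2

theorem memLp_inverseIntegral {w : Freq → ℂ} (hw : Integrable w freqMeasure)
    (hw2 : MemLp w 2 freqMeasure) : MemLp (inverseIntegral w) 2 :=
  isPlancherelKernel_freq.memLp_integral hw hw2

theorem eLpNorm_fourierIntegral {u : Phys → ℂ} (hu : Integrable u) (hu2 : MemLp u 2) :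
    eLpNorm (fourierIntegral u) 2 freqMeasure =
      ENNReal.ofReal (√plancherelConst) * eLpNorm u 2 :=
  isPlancherelKernel_phys.eLpNorm_integral hu hu2

theorem eLpNorm_inverseIntegral {w : Freq → ℂ} (hw : Integrable w freqMeasure)
    (hw2 : MemLp w 2 freqMeasure) :
    eLpNorm (inverseIntegral w) 2 =
      ENNReal.ofReal (√plancherelConst) * eLpNorm w 2 freqMeasure :=
  isPlancherelKernel_freq.eLpNorm_integral hw hw2

theorem eLpNorm_inverseIntegral_sub {u : Phys → ℂ} {w : Freq → ℂ} (hu : Integrable u)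
    (hu2 : MemLp u 2) (hw : Integrable w freqMeasure) (hw2 : MemLp w 2 freqMeasure) :
    eLpNorm (inverseIntegral w - (plancherelConst : ℂ) • u) 2 =
      ENNReal.ofReal (√plancherelConst) * eLpNorm (w - fourierIntegral u) 2 freqMeasure :=
  isPlancherelKernel_phys.eLpNorm_adjoint_sub isPlancherelKernel_freq plancherelConst_pos.le
    hu hu2 hw hw2

theorem eLpNorm_sub_le_add_sub {X : Type*} [MeasurableSpace X] {μ : Measure X} {f g h : X → ℂ}
    (hf : AEStronglyMeasurable f μ) (hg : AEStronglyMeasurable g μ)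
    (hh : AEStronglyMeasurable h μ) :
    eLpNorm (f - h) 2 μ ≤ eLpNorm (f - g) 2 μ + eLpNorm (g - h) 2 μ := by
  rw [← sub_add_sub_cancel f g h]
  exact eLpNorm_add_le (hf.sub hg) (hg.sub hh) (by norm_num)

namespace IsFourierTransform

variable {u : Phys → ℂ} {v : Freq → ℂ}

theorem tendsto_eLpNorm_sub (h : IsFourierTransform u v) :
    Tendsto (fun R : ℝ => eLpNorm (fourierIntegral ((box R).indicator u) - v) 2 freqMeasure)
      atTop (𝓝 0) := by
  refine h.2.congr fun R => ?_
  rw [truncatedFourier_eq]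
  rfl

theorem eLpNorm_le (h : IsFourierTransform u v) (hu : MemLp u 2) :
    eLpNorm v 2 freqMeasure ≤ ENNReal.ofReal (√plancherelConst) * eLpNorm u 2 := by
  have hlim := h.tendsto_eLpNorm_sub.const_add (ENNReal.ofReal (√plancherelConst) * eLpNorm u 2)
  rw [add_zero] at hlim
  refine ge_of_tendsto' hlim fun R => ?_
  have hi := integrable_indicator_box hu R
  have h2 : MemLp ((box R).indicator u) 2 := hu.indicator (measurableSet_box R)
  have hF := memLp_fourierIntegral hi h2
  calc eLpNorm v 2 freqMeasure
      = eLpNorm (fourierIntegral ((box R).indicator u) -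
          (fourierIntegral ((box R).indicator u) - v)) 2 freqMeasure := by rw [sub_sub_cancel]
    _ ≤ _ := eLpNorm_sub_le hF.1 (hF.1.sub h.1.1) (by norm_num)
    _ ≤ _ := by
        rw [eLpNorm_fourierIntegral hi h2]
        gcongr
        exact eLpNorm_indicator_le _

/-- Inversion for general `u ∈ L²`: the identity `eLpNorm_inverseIntegral_sub` holds for `u` cut off
to a box, and both cut-off errors vanish as the box grows. -/
theorem eLpNorm_inverseIntegral_sub_le (h : IsFourierTransform u v) (hu : MemLp u 2)
    {w : Freq → ℂ} (hw : Integrable w freqMeasure) (hw2 : MemLp w 2 freqMeasure) :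
    eLpNorm (inverseIntegral w - (plancherelConst : ℂ) • u) 2 ≤
      ENNReal.ofReal (√plancherelConst) * eLpNorm (w - v) 2 freqMeasure := by
  have hlim := ((ENNReal.Tendsto.const_mul (a := ENNReal.ofReal (√plancherelConst))
    (h.tendsto_eLpNorm_sub.const_add (eLpNorm (w - v) 2 freqMeasure))
    (Or.inr ENNReal.ofReal_ne_top)).add
    (ENNReal.Tendsto.const_mul (a := ‖(plancherelConst : ℂ)‖ₑ) (tendsto_eLpNorm_box hu)
    (Or.inr enorm_ne_top)))
  simp only [add_zero, mul_zero] at hlim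
  refine ge_of_tendsto' hlim fun R => ?_
  have hi := integrable_indicator_box hu R
  have h2 : MemLp ((box R).indicator u) 2 := hu.indicator (measurableSet_box R)
  have hF := memLp_fourierIntegral hi h2
  have hI := memLp_inverseIntegral hw hw2
  refine (eLpNorm_sub_le_add_sub hI.1 (h2.1.const_smul (plancherelConst : ℂ))
    (hu.1.const_smul (plancherelConst : ℂ))).trans ?_
  rw [eLpNorm_inverseIntegral_sub hi h2 hw hw2, ← smul_sub, eLpNorm_const_smul]
  gcongr
  · refine (eLpNorm_sub_le_add_sub hw2.1 h.1.1 hF.1).trans_eq ?_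
    rw [eLpNorm_sub_comm v]
  · exact le_rfl

end IsFourierTransform

/-! ### Bilinear estimate from the measure of intersections -/

instance : freqMeasure.IsAddLeftInvariant := by unfold freqMeasure; infer_instance
instance : freqMeasure.IsAddRightInvariant := by unfold freqMeasure; infer_instance

/-- Cauchy–Schwarz against the indicator of `S`. -/
theorem lintegral_sq_le_measure_mul {X : Type*} [MeasurableSpace X] {μ : Measure X}
    {F : X → ℝ≥0∞} (hF : AEMeasurable F μ) {S : Set X} (hS : MeasurableSet S)
    (h0 : ∀ x, x ∉ S → F x = 0) : (∫⁻ x, F x ∂μ) ^ 2 ≤ μ S * ∫⁻ x, F x ^ 2 ∂μ := by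
  have h := ENNReal.lintegral_mul_le_Lp_mul_Lq μ Real.HolderConjugate.two_two
    (f := S.indicator 1) (g := F) ((measurable_const.indicator hS).aemeasurable) hF
  have e1 : ∀ x, (S.indicator (1 : X → ℝ≥0∞) * F) x = F x := fun x => by
    by_cases hx : x ∈ S
    · simp [hx]
    · simp [hx, h0 x hx]
  have e2 : ∀ x, (S.indicator (1 : X → ℝ≥0∞) x) ^ (2 : ℝ) = S.indicator 1 x := fun x => by
    by_cases hx : x ∈ S <;> simp [hx]
  simp only [e1, e2] at h
  rw [lintegral_indicator_one hS] at h
  calc (∫⁻ x, F x ∂μ) ^ 2 ≤ _ := pow_le_pow_left' h 2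
    _ = _ := by
      rw [mul_pow, ← ENNReal.rpow_natCast, ← ENNReal.rpow_natCast, ← ENNReal.rpow_mul,
        ← ENNReal.rpow_mul]
      norm_num

/-- Young-type estimate for the convolution of functions with supports in `H₁`, `H₂`, in terms
of the measure of the intersections of `H₁` with the translates of `-H₂`. -/
theorem eLpNorm_convolution_le {H₁ H₂ : Set Freq} (hH₁ : MeasurableSet H₁)
    (hH₂ : MeasurableSet H₂) {A : ℝ≥0∞}
    (hA : ∀ q, freqMeasure {q' | q' ∈ H₁ ∧ q - q' ∈ H₂} ≤ A) {w₁ w₂ : Freq → ℂ}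
    (hm₁ : Measurable w₁) (hm₂ : Measurable w₂) (hw₁ : ∀ q, q ∉ H₁ → w₁ q = 0)
    (hw₂ : ∀ q, q ∉ H₂ → w₂ q = 0) :
    eLpNorm (w₁ ⋆[ContinuousLinearMap.mul ℂ ℂ, freqMeasure] w₂) 2 freqMeasure ≤
      A ^ (1 / 2 : ℝ) * eLpNorm w₁ 2 freqMeasure * eLpNorm w₂ 2 freqMeasure := by
  have hpt : ∀ q, ‖(w₁ ⋆[ContinuousLinearMap.mul ℂ ℂ, freqMeasure] w₂) q‖ₑ ^ 2 ≤
      A * ∫⁻ q', ‖w₁ q'‖ₑ ^ 2 * ‖w₂ (q - q')‖ₑ ^ 2 ∂freqMeasure := fun q => by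
    have hS : MeasurableSet {q' | q' ∈ H₁ ∧ q - q' ∈ H₂} :=
      hH₁.inter ((measurable_const.sub measurable_id) hH₂)
    calc ‖(w₁ ⋆[ContinuousLinearMap.mul ℂ ℂ, freqMeasure] w₂) q‖ₑ ^ 2
        ≤ (∫⁻ q', ‖w₁ q'‖ₑ * ‖w₂ (q - q')‖ₑ ∂freqMeasure) ^ 2 := by
          refine pow_le_pow_left' ((enorm_integral_le_lintegral_enorm _).trans_eq ?_) 2
          simp [enorm_mul]
      _ ≤ freqMeasure {q' | q' ∈ H₁ ∧ q - q' ∈ H₂} *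
          ∫⁻ q', (‖w₁ q'‖ₑ * ‖w₂ (q - q')‖ₑ) ^ 2 ∂freqMeasure := by
          refine lintegral_sq_le_measure_mul (by fun_prop) hS fun q' hq' => ?_
          simp only [Set.mem_ofPred_eq, not_and_or] at hq'
          rcases hq' with h | h
          · simp [hw₁ _ h]
          · simp [hw₂ _ h]
      _ ≤ _ := by
          simp only [mul_pow]
          gcongr
          exact hA q
  rw [← ENNReal.pow_le_pow_left_iff two_ne_zero, eLpNorm_two_sq, mul_pow, mul_pow,
    eLpNorm_two_sq, eLpNorm_two_sq, ← ENNReal.rpow_natCast, ← ENNReal.rpow_mul]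
  calc _ ≤ ∫⁻ q, A * ∫⁻ q', ‖w₁ q'‖ₑ ^ 2 * ‖w₂ (q - q')‖ₑ ^ 2 ∂freqMeasure ∂freqMeasure :=
        lintegral_mono hpt
    _ = A * ∫⁻ q, ∫⁻ q', ‖w₁ q'‖ₑ ^ 2 * ‖w₂ (q - q')‖ₑ ^ 2 ∂freqMeasure ∂freqMeasure := by
        refine lintegral_const_mul _ ?_
        refine Measurable.lintegral_prod_right'
          (f := fun z : Freq × Freq => ‖w₁ z.2‖ₑ ^ 2 * ‖w₂ (z.1 - z.2)‖ₑ ^ 2) (by fun_prop)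
    _ = A * ∫⁻ q', ∫⁻ q, ‖w₁ q'‖ₑ ^ 2 * ‖w₂ (q - q')‖ₑ ^ 2 ∂freqMeasure ∂freqMeasure := by
        rw [lintegral_lintegral_swap]
        have : Measurable fun z : Freq × Freq => ‖w₁ z.2‖ₑ ^ 2 * ‖w₂ (z.1 - z.2)‖ₑ ^ 2 := by
          fun_prop
        exact this.aemeasurable
    _ = _ := by
        -- After Tonelli, translation invariance splits the double integral into a product.
        have : ∀ q', ∫⁻ q, ‖w₁ q'‖ₑ ^ 2 * ‖w₂ (q - q')‖ₑ ^ 2 ∂freqMeasure =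
            ‖w₁ q'‖ₑ ^ 2 * ∫⁻ q, ‖w₂ q‖ₑ ^ 2 ∂freqMeasure := fun q' => by
          rw [lintegral_const_mul _ (by fun_prop),
            lintegral_sub_right_eq_self (fun q => ‖w₂ q‖ₑ ^ 2) q']
        simp only [this]
        rw [lintegral_mul_const _ (by fun_prop)]
        norm_num [mul_assoc]

theorem conjCharacter_add (q q' : Freq) (p : Phys) :
    conjCharacter (q + q') p = conjCharacter q p * conjCharacter q' p := by
  simp only [conjCharacter, Prod.fst_add, Prod.snd_add, neg_add, fourier_add]
  rw [mul_mul_mul_comm, ← Complex.exp_add]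
  congr 2
  push_cast
  ring

theorem integrable_mul_conj_conjCharacter {w : Freq → ℂ} (hw : Integrable w freqMeasure)
    (p : Phys) : Integrable (fun q => w q * conj (conjCharacter q p)) freqMeasure :=
  isPlancherelKernel_freq.integrable_mul hw p

/-- The inverse Fourier integral maps convolutions to products. -/
theorem inverseIntegral_convolution {w₁ w₂ : Freq → ℂ} (hw₁ : Integrable w₁ freqMeasure)
    (hw₂ : Integrable w₂ freqMeasure) :
    inverseIntegral (w₁ ⋆[ContinuousLinearMap.mul ℂ ℂ, freqMeasure] w₂) =
      fun p => inverseIntegral w₁ p * inverseIntegral w₂ p := by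
  ext p
  have h := integral_convolution (μ := freqMeasure) (ν := freqMeasure)
    (ContinuousLinearMap.mul ℂ ℂ) (integrable_mul_conj_conjCharacter hw₁ p)
    (integrable_mul_conj_conjCharacter hw₂ p)
  rw [ContinuousLinearMap.mul_apply'] at h
  rw [inverseIntegral, inverseIntegral, inverseIntegral, ← h]
  refine integral_congr_ae (ae_of_all _ fun q => ?_)
  simp only [convolution_def, ContinuousLinearMap.mul_apply']
  rw [← integral_mul_const]
  refine integral_congr_ae (ae_of_all _ fun q' => ?_)
  simp only
  conv_lhs => rw [← add_sub_cancel q' q, conjCharacter_add, add_sub_cancel]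
  rw [map_mul]
  ring

theorem eLpNorm_inverseIntegral_mul_le {H₁ H₂ : Set Freq} (hH₁ : MeasurableSet H₁)
    (hH₂ : MeasurableSet H₂) {A : ℝ≥0∞} (hAt : A ≠ ∞)
    (hA : ∀ q, freqMeasure {q' | q' ∈ H₁ ∧ q - q' ∈ H₂} ≤ A) {w₁ w₂ : Freq → ℂ}
    (hm₁ : Measurable w₁) (hm₂ : Measurable w₂) (hw₁ : ∀ q, q ∉ H₁ → w₁ q = 0)
    (hw₂ : ∀ q, q ∉ H₂ → w₂ q = 0) (hi₁ : Integrable w₁ freqMeasure)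
    (hi₂ : Integrable w₂ freqMeasure) (h₁ : MemLp w₁ 2 freqMeasure)
    (h₂ : MemLp w₂ 2 freqMeasure) :
    eLpNorm (fun p => inverseIntegral w₁ p * inverseIntegral w₂ p) 2 ≤
      ENNReal.ofReal (√plancherelConst) *
        (A ^ (1 / 2 : ℝ) * eLpNorm w₁ 2 freqMeasure * eLpNorm w₂ 2 freqMeasure) := by
  have hle := eLpNorm_convolution_le hH₁ hH₂ hA hm₁ hm₂ hw₁ hw₂
  have hci := hi₁.integrable_convolution (ContinuousLinearMap.mul ℂ ℂ) hi₂
  have hc2 : MemLp (w₁ ⋆[ContinuousLinearMap.mul ℂ ℂ, freqMeasure] w₂) 2 freqMeasure :=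
    ⟨hci.1, hle.trans_lt (ENNReal.mul_lt_top (ENNReal.mul_lt_top
      (ENNReal.rpow_lt_top_of_nonneg (by norm_num) hAt) h₁.2) h₂.2)⟩
  rw [← inverseIntegral_convolution hi₁ hi₂, eLpNorm_inverseIntegral hci hc2]
  gcongr

/-- The box `[-k, k] × [-k, k] × {-k, …, k}`. -/
def freqBox (k : ℕ) : Set Freq := {q | |q.1| ≤ k ∧ |q.2.1| ≤ k ∧ |q.2.2| ≤ k}

theorem freqBox_eq (k : ℕ) : freqBox k =
    Set.Icc (-k : ℝ) k ×ˢ (Set.Icc (-k : ℝ) k ×ˢ Set.Icc (-k : ℤ) k) := by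
  ext q
  simp only [freqBox, Set.mem_ofPred_eq, Set.mem_prod, Set.mem_Icc, abs_le]

theorem measurableSet_freqBox (k : ℕ) : MeasurableSet (freqBox k) := by
  rw [freqBox_eq]
  exact measurableSet_Icc.prod (measurableSet_Icc.prod measurableSet_Icc)

theorem freqMeasure_freqBox_lt_top (k : ℕ) : freqMeasure (freqBox k) < ∞ := by
  rw [freqBox_eq, freqMeasure, Measure.prod_prod, Measure.prod_prod]
  refine ENNReal.mul_lt_top measure_Icc_lt_top (ENNReal.mul_lt_top measure_Icc_lt_top ?_)
  rw [Measure.count_apply_lt_top]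
  exact Set.finite_Icc _ _

/-- The inverse integrals of frequency truncations converge to the function, and are supported
and bounded like its transform. -/
theorem FourierSupportedIn.exists_approx {u : Phys → ℂ} {H : Set Freq} (hu : MemLp u 2)
    (h : FourierSupportedIn u H) (hH : MeasurableSet H) :
    ∃ w : ℕ → Freq → ℂ, (∀ k, Measurable (w k)) ∧ (∀ k q, q ∉ H → w k q = 0) ∧
      (∀ k, Integrable (w k) freqMeasure) ∧ (∀ k, MemLp (w k) 2 freqMeasure) ∧
      (∀ k, eLpNorm (w k) 2 freqMeasure ≤ ENNReal.ofReal (√plancherelConst) * eLpNorm u 2) ∧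
      Tendsto (fun k => eLpNorm (inverseIntegral (w k) - (plancherelConst : ℂ) • u) 2) atTop
        (𝓝 0) := by
  obtain ⟨v, hv, hvH⟩ := h
  set v' := hv.1.1.mk v with hv'
  have hae : v =ᵐ[freqMeasure] v' := hv.1.1.ae_eq_mk
  have hvm : Measurable v' := hv.1.1.stronglyMeasurable_mk.measurable
  have h2 : MemLp v' 2 freqMeasure := hv.1.ae_eq hae
  have hm : ∀ k, MeasurableSet (H ∩ freqBox k) := fun k => hH.inter (measurableSet_freqBox k)
  have hw2 : ∀ k, MemLp ((H ∩ freqBox k).indicator v') 2 freqMeasure :=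
    fun k => h2.indicator (hm k)
  have hwi : ∀ k, Integrable ((H ∩ freqBox k).indicator v') freqMeasure := fun k => by
    rw [integrable_indicator_iff (hm k)]
    have hlt : freqMeasure (H ∩ freqBox k) < ∞ :=
      (measure_mono Set.inter_subset_right).trans_lt (freqMeasure_freqBox_lt_top k)
    have : IsFiniteMeasure (freqMeasure.restrict (H ∩ freqBox k)) := ⟨by simpa using hlt⟩
    exact (h2.restrict _).integrable (by norm_num)
  refine ⟨fun k => (H ∩ freqBox k).indicator v', fun k => hvm.indicator (hm k),
    fun k q hq => Set.indicator_of_notMem (fun h => hq h.1) _, hwi, hw2, fun k => ?_, ?_⟩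
  · refine (eLpNorm_indicator_le _).trans ?_
    rw [← eLpNorm_congr_ae hae]
    exact hv.eLpNorm_le hu
  · have hlim : Tendsto (fun k : ℕ => eLpNorm
        (fun q => (freqBox k).indicator v' q - v' q) 2 freqMeasure) atTop (𝓝 0) := by
      refine tendsto_eLpNorm_indicator_sub h2 measurableSet_freqBox fun q => ?_
      obtain ⟨N₁, hN₁⟩ := exists_nat_ge |q.1|
      obtain ⟨N₂, hN₂⟩ := exists_nat_ge |q.2.1|
      filter_upwards [eventually_ge_atTop N₁, eventually_ge_atTop N₂,
        eventually_ge_atTop q.2.2.natAbs] with k h1 h2 h3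
      refine ⟨hN₁.trans (by exact_mod_cast h1), hN₂.trans (by exact_mod_cast h2), ?_⟩
      rw [Int.abs_eq_natAbs]
      exact_mod_cast h3
    have hlim2 := ENNReal.Tendsto.const_mul (a := ENNReal.ofReal (√plancherelConst)) hlim
      (Or.inr ENNReal.ofReal_ne_top)
    rw [mul_zero] at hlim2
    refine tendsto_of_tendsto_of_tendsto_of_le_of_le tendsto_const_nhds hlim2
      (fun _ => zero_le) fun k => ?_
    refine (hv.eLpNorm_inverseIntegral_sub_le hu (hwi k) (hw2 k)).trans_eq ?_
    congr 1
    refine eLpNorm_congr_ae ?_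
    filter_upwards [hae, hvH] with q hq hqH
    rw [Pi.sub_apply, ← hq]
    congr 1
    by_cases hqH' : q ∈ H
    · by_cases hb : q ∈ freqBox k <;> simp [hqH', hb]
    · have : v' q = 0 := by rw [← hq, hqH hqH']
      by_cases hb : q ∈ freqBox k <;> simp [hqH', hb, this]

theorem one_le_plancherelConst : 1 ≤ plancherelConst := by
  have h : 1 ≤ 2 * π := by linarith [Real.pi_gt_three]
  unfold plancherelConst
  exact one_le_mul_of_one_le_of_one_le h (one_le_mul_of_one_le_of_one_le h h)

/-- The product of two functions with Fourier supports in `H₁` and `H₂` is controlled by the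
measure of the intersections of `H₁` with the translates of `-H₂`. -/
theorem eLpNorm_mul_le_of_freqMeasure_le {H₁ H₂ : Set Freq} (hH₁ : MeasurableSet H₁)
    (hH₂ : MeasurableSet H₂) {A : ℝ≥0∞} (hAt : A ≠ ∞)
    (hA : ∀ q, freqMeasure {q' | q' ∈ H₁ ∧ q - q' ∈ H₂} ≤ A) {u₁ u₂ : Phys → ℂ}
    (hu₁ : MemLp u₁ 2) (hu₂ : MemLp u₂ 2) (h₁ : FourierSupportedIn u₁ H₁)
    (h₂ : FourierSupportedIn u₂ H₂) :
    eLpNorm (fun p => u₁ p * u₂ p) 2 ≤ A ^ (1 / 2 : ℝ) * eLpNorm u₁ 2 * eLpNorm u₂ 2 := by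
  obtain ⟨w₁, hm₁, hs₁, hi₁, hl₁, hb₁, ht₁⟩ := h₁.exists_approx hu₁ hH₁
  obtain ⟨w₂, hm₂, hs₂, hi₂, hl₂, hb₂, ht₂⟩ := h₂.exists_approx hu₂ hH₂
  have hI₁ := fun k => (memLp_inverseIntegral (hi₁ k) (hl₁ k)).1
  have hI₂ := fun k => (memLp_inverseIntegral (hi₂ k) (hl₂ k)).1
  -- Successive extraction: `ms` is chosen along `ns`, so both approximations converge a.e. along
  -- `ns ∘ ms`. Fatou then bounds the norm of the limit product.
  obtain ⟨ns, hns, hae₁⟩ := (tendstoInMeasure_of_tendsto_eLpNorm two_ne_zero hI₁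
    (hu₁.1.const_smul _) ht₁).exists_seq_tendsto_ae
  obtain ⟨ms, hms, hae₂⟩ := (tendstoInMeasure_of_tendsto_eLpNorm two_ne_zero
    (fun k => hI₂ (ns k)) (hu₂.1.const_smul _)
    (ht₂.comp hns.tendsto_atTop)).exists_seq_tendsto_ae
  set s := ENNReal.ofReal (√plancherelConst) with hs
  have hs1 : 1 ≤ s := by
    rw [hs, ENNReal.one_le_ofReal, Real.one_le_sqrt]
    exact one_le_plancherelConst
  have hst : s ≠ ∞ := ENNReal.ofReal_ne_top
  have hD : ‖(plancherelConst : ℂ)‖ₑ = s ^ 2 := by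
    rw [← ofReal_norm, Complex.norm_real, Real.norm_of_nonneg plancherelConst_pos.le, hs,
      ← ENNReal.ofReal_pow (Real.sqrt_nonneg _), Real.sq_sqrt plancherelConst_pos.le]
  have hlim := Lp.eLpNorm_lim_le_liminf_eLpNorm (p := 2) (μ := (volume : Measure Phys))
    (f := fun k p => inverseIntegral (w₁ (ns (ms k))) p * inverseIntegral (w₂ (ns (ms k))) p)
    (fun k => (hI₁ _).mul (hI₂ _))
    (fun p => ((plancherelConst : ℂ) • u₁) p * ((plancherelConst : ℂ) • u₂) p) (by
      filter_upwards [hae₁, hae₂] with p hp₁ hp₂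
      exact (hp₁.comp hms.tendsto_atTop).mul hp₂)
  have hbound : ∀ k, eLpNorm (fun p => inverseIntegral (w₁ (ns (ms k))) p *
      inverseIntegral (w₂ (ns (ms k))) p) 2 ≤
      s ^ 3 * (A ^ (1 / 2 : ℝ) * eLpNorm u₁ 2 * eLpNorm u₂ 2) := fun k => by
    refine (eLpNorm_inverseIntegral_mul_le hH₁ hH₂ hAt hA (hm₁ _) (hm₂ _) (hs₁ _) (hs₂ _)
      (hi₁ _) (hi₂ _) (hl₁ _) (hl₂ _)).trans ?_
    calc _ ≤ s * (A ^ (1 / 2 : ℝ) * (s * eLpNorm u₁ 2) * (s * eLpNorm u₂ 2)) := by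
          gcongr
          · exact hb₁ _
          · exact hb₂ _
      _ = _ := by ring
  have hle := hlim.trans (liminf_le_of_frequently_le' (Frequently.of_forall hbound))
  have e : (fun p => ((plancherelConst : ℂ) • u₁) p * ((plancherelConst : ℂ) • u₂) p) =
      ((plancherelConst : ℂ) * plancherelConst) • fun p => u₁ p * u₂ p := by
    ext p
    simp only [Pi.smul_apply, smul_eq_mul]
    ring
  rw [e, eLpNorm_const_smul, enorm_mul, hD] at hle
  -- The limit carries `s ^ 4` (two factors `plancherelConst = s²`), the bound only `s ^ 3`; the
  -- spare factor `s ≥ 1` is dropped.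
  have hs0 : s ^ 3 ≠ 0 := pow_ne_zero _ (zero_lt_one.trans_le hs1).ne'
  rw [← ENNReal.mul_le_mul_iff_right hs0 (ENNReal.pow_ne_top hst)]
  refine le_trans ?_ hle
  gcongr
  rw [← pow_add]
  exact pow_le_pow_right₀ hs1 (by norm_num)

/-! ### Convexity and growth of the pair symbol -/

/-- The excess of `|x|^{2α}` over `x²` outside `[-1, 1]`, extended by zero. -/
def powerExcess (α x : ℝ) : ℝ := (max (x ^ 2) 1) ^ α - max (x ^ 2) 1

theorem self_le_rpow {α s : ℝ} (hα : 1 ≤ α) (hs : 1 ≤ s) : s ≤ s ^ α := by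
  simpa using Real.rpow_le_rpow_of_exponent_le hs hα

theorem powerExcess_nonneg {α : ℝ} (hα : 1 ≤ α) (x : ℝ) : 0 ≤ powerExcess α x :=
  sub_nonneg.2 (self_le_rpow hα (le_max_right _ _))

/-- The function `s ^ α - s` is convex and increasing on `[1, ∞)`, and `max (x²) 1` is convex with
values there. The cut-off at `1` matters: for `α > 1`, `|x|^{2α} - x²` is not convex near `0`. -/
theorem convexOn_powerExcess {α : ℝ} (hα : 1 ≤ α) : ConvexOn ℝ Set.univ (powerExcess α) := by
  have hsub : (fun x : ℝ => max (x ^ 2) 1) '' Set.univ ⊆ Set.Ici 1 := by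
    rintro _ ⟨x, -, rfl⟩
    exact le_max_right (x ^ 2) 1
  have hin : ConvexOn ℝ Set.univ fun x : ℝ => max (x ^ 2) 1 :=
    (even_two.convexOn_pow).sup (convexOn_const 1 convex_univ)
  have himg : Convex ℝ ((fun x : ℝ => max (x ^ 2) 1) '' Set.univ) := by
    refine Set.OrdConnected.convex ?_
    refine (isPreconnected_univ.image _ ?_).ordConnected
    exact Continuous.continuousOn (by fun_prop)
  have hout : ConvexOn ℝ (Set.Ici 1) fun s : ℝ => s ^ α - s :=
    ((convexOn_rpow hα).subset (Set.Ici_subset_Ici.2 zero_le_one) (convex_Ici 1)).sub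
      (concaveOn_id (convex_Ici 1))
  have hmono : MonotoneOn (fun s : ℝ => s ^ α - s) (Set.Ici 1) := by
    intro s hs t ht hst
    have hs0 : (0 : ℝ) < s := zero_lt_one.trans_le hs
    have ht0 : (0 : ℝ) < t := zero_lt_one.trans_le ht
    have e : ∀ r : ℝ, 0 < r → r ^ α - r = r * (r ^ (α - 1) - 1) := fun r hr => by
      rw [Real.rpow_sub_one hr.ne']
      field_simp
    simp only [e s hs0, e t ht0]
    have h1 : s ^ (α - 1) ≤ t ^ (α - 1) := Real.rpow_le_rpow hs0.le hst (by linarith)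
    have h2 : 1 ≤ s ^ (α - 1) := Real.one_le_rpow hs (by linarith)
    exact mul_le_mul hst (by linarith) (by linarith) ht0.le
  exact (hout.subset hsub himg).comp hin (hmono.mono hsub)

/-- The cut-off is invisible at integers: `m² ≥ 1` unless `m = 0`, where both sides vanish. -/
theorem abs_rpow_eq_sq_add_powerExcess {α : ℝ} (hα : 1 ≤ α) (m : ℤ) :
    |(m : ℝ)| ^ (2 * α) = (m : ℝ) ^ 2 + powerExcess α m := by
  rcases eq_or_ne m 0 with rfl | hm
  · simp [powerExcess, Real.zero_rpow (by linarith : 2 * α ≠ 0)]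
  · have h1 : (1 : ℝ) ≤ (m : ℝ) ^ 2 := by
      have : (1 : ℤ) ≤ m ^ 2 := by
        have := sq_pos_of_ne_zero hm
        linarith
      exact_mod_cast this
    rw [powerExcess, max_eq_left h1, Real.rpow_mul (abs_nonneg _), Real.rpow_two, sq_abs]
    ring

/-- The points `c ± l` are convex combinations of `c ± l'` with weights `(l' ± l) / (2 l')`; the two
convexity inequalities add up. -/
theorem _root_.ConvexOn.add_symm_le {f : ℝ → ℝ} (hf : ConvexOn ℝ Set.univ f) {c l l' : ℝ}
    (hl : 0 ≤ l) (hll' : l ≤ l') : f (c + l) + f (c - l) ≤ f (c + l') + f (c - l') := by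
  rcases hl.eq_or_lt with rfl | hl0
  · have h := hf.2 (Set.mem_univ (c + l')) (Set.mem_univ (c - l'))
      (by norm_num : (0 : ℝ) ≤ 1 / 2) (by norm_num : (0 : ℝ) ≤ 1 / 2) (by norm_num)
    have e : (1 / 2 : ℝ) • (c + l') + (1 / 2 : ℝ) • (c - l') = c := by
      simp only [smul_eq_mul]; ring
    rw [e] at h
    simp only [smul_eq_mul] at h
    simp only [add_zero, sub_zero]
    linarith
  · have hl' : 0 < l' := hl0.trans_le hll'
    have ha : 0 ≤ (l' + l) / (2 * l') := by positivity
    have hb : 0 ≤ (l' - l) / (2 * l') := div_nonneg (by linarith) (by linarith)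
    have hab : (l' + l) / (2 * l') + (l' - l) / (2 * l') = 1 := by field_simp; ring
    have h1 := hf.2 (Set.mem_univ (c + l')) (Set.mem_univ (c - l')) ha hb hab
    have h2 := hf.2 (Set.mem_univ (c + l')) (Set.mem_univ (c - l')) hb ha (by linarith)
    have e1 : ((l' + l) / (2 * l')) • (c + l') + ((l' - l) / (2 * l')) • (c - l') = c + l := by
      simp only [smul_eq_mul]; field_simp; ring
    have e2 : ((l' - l) / (2 * l')) • (c + l') + ((l' + l) / (2 * l')) • (c - l') = c - l := by
      simp only [smul_eq_mul]; field_simp; ring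
    rw [e1] at h1
    rw [e2] at h2
    simp only [smul_eq_mul] at h1 h2
    have h3 : (l' - l) / (2 * l') = 1 - (l' + l) / (2 * l') := by linarith
    rw [h3] at h1 h2
    linarith

/-- The symbol `|m|^{2α} + |n - m|^{2α}` of two interacting transversal frequencies. -/
def pairSymbol (α : ℝ) (n m : ℤ) : ℝ := |(m : ℝ)| ^ (2 * α) + |((n - m : ℤ) : ℝ)| ^ (2 * α)

theorem pairSymbol_sub (α : ℝ) (n m : ℤ) : pairSymbol α n (n - m) = pairSymbol α n m := by
  rw [pairSymbol, pairSymbol, sub_sub_cancel, add_comm]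

/-- A crude bound, which only serves to bound above the indices with non-null slices. -/
theorem le_pairSymbol {α : ℝ} (hα : 1 ≤ α) (n m : ℤ) : (m : ℝ) - 1 ≤ pairSymbol α n m := by
  have h1 := abs_rpow_eq_sq_add_powerExcess hα m
  have h2 := powerExcess_nonneg hα m
  have h3 : 0 ≤ |((n - m : ℤ) : ℝ)| ^ (2 * α) := by positivity
  rw [pairSymbol]
  nlinarith [sq_nonneg ((m : ℝ) - 1)]

/-- Quadratic growth of the pair symbol away from its centre `n / 2`. -/
theorem pairSymbol_growth {α : ℝ} (hα : 1 ≤ α) {n m m' : ℤ} (h : n ≤ 2 * m) (hm : m ≤ m') :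
    2 * (((m' - m : ℤ) : ℝ) * ((m' : ℝ) - n / 2)) ≤ pairSymbol α n m' - pairSymbol α n m := by
  have h' : (n : ℝ) ≤ 2 * m := by exact_mod_cast h
  have hm' : (m : ℝ) ≤ m' := by exact_mod_cast hm
  have key := (convexOn_powerExcess hα).add_symm_le (c := n / 2) (l := m - n / 2)
    (l' := m' - n / 2) (by linarith) (by linarith)
  have e : ∀ k : ℤ, pairSymbol α n k = (k : ℝ) ^ 2 + (n - k : ℝ) ^ 2 +
      (powerExcess α (n / 2 + (k - n / 2)) + powerExcess α (n / 2 - (k - n / 2))) := fun k => by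
    rw [pairSymbol, abs_rpow_eq_sq_add_powerExcess hα, abs_rpow_eq_sq_add_powerExcess hα]
    push_cast
    ring_nf
  rw [e, e]
  push_cast
  -- The quadratic parts differ by `2 (m' - m) (m' + m - n)`, and `m ≥ n / 2`.
  nlinarith [mul_nonneg (sub_nonneg.2 hm') (by linarith : (0 : ℝ) ≤ m - n / 2)]

/-! ### Lengths of slices and their sum over `m` -/

/-- The distance `|x - c|` lies between the two roots, which leaves two intervals. For negative
radicands `√` is `0`, so no case distinction is needed. -/
theorem volume_abs_two_mul_sq_sub_le (c h K : ℝ) :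
    volume {x : ℝ | |2 * (x - c) ^ 2 - h| ≤ 4 * K} ≤
      ENNReal.ofReal (2 * (√((h + 4 * K) / 2) - √((h - 4 * K) / 2))) := by
  set a := √((h - 4 * K) / 2)
  set b := √((h + 4 * K) / 2)
  have hsub : {x : ℝ | |2 * (x - c) ^ 2 - h| ≤ 4 * K} ⊆
      Set.Icc (c + a) (c + b) ∪ Set.Icc (c - b) (c - a) := by
    intro x hx
    rw [Set.mem_ofPred_eq] at hx
    obtain ⟨h1, h2⟩ := abs_le.1 hx
    have ha : a ≤ |x - c| := Real.sqrt_le_iff.2 ⟨abs_nonneg _, by rw [sq_abs]; linarith⟩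
    have hb : |x - c| ≤ b := Real.abs_le_sqrt (by linarith)
    rcases le_total 0 (x - c) with h0 | h0
    · rw [abs_of_nonneg h0] at ha hb
      exact Or.inl ⟨by linarith, by linarith⟩
    · rw [abs_of_nonpos h0] at ha hb
      exact Or.inr ⟨by linarith, by linarith⟩
  refine (measure_mono hsub).trans ((measure_union_le _ _).trans ?_)
  rw [Real.volume_Icc, Real.volume_Icc, ENNReal.ofReal_mul zero_le_two, add_sub_add_left_eq_sub,
    sub_sub_sub_cancel_left, ENNReal.ofReal_ofNat, two_mul]

theorem sqrt_sub_sqrt_le_sqrt_sub {P Q : ℝ} (h : P ≤ Q) : √Q - √P ≤ √(Q - P) := by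
  rw [sub_le_iff_le_add]
  refine Real.sqrt_le_iff.2 ⟨by positivity, ?_⟩
  have h1 : P ≤ √P ^ 2 := by
    rcases le_total 0 P with hP | hP
    · rw [Real.sq_sqrt hP]
    · exact hP.trans (sq_nonneg _)
  nlinarith [Real.sq_sqrt (sub_nonneg.2 h), Real.sqrt_nonneg (Q - P), Real.sqrt_nonneg P]

theorem volume_slice_le_sqrt (c h : ℝ) {K : ℝ} (hK : 1 ≤ K) :
    volume {x : ℝ | |2 * (x - c) ^ 2 - h| ≤ 4 * K} ≤ ENNReal.ofReal (4 * √K) := by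
  refine (volume_abs_two_mul_sq_sub_le c h K).trans (ENNReal.ofReal_le_ofReal ?_)
  have h1 := sqrt_sub_sqrt_le_sqrt_sub (P := (h - 4 * K) / 2) (Q := (h + 4 * K) / 2) (by linarith)
  have h2 : (h + 4 * K) / 2 - (h - 4 * K) / 2 = 2 ^ 2 * K := by ring
  rw [h2, Real.sqrt_mul (by norm_num), Real.sqrt_sq zero_le_two] at h1
  linarith

/-- If `T ≥ 8K`, the lower radicand is at least `T / 2` and the difference of roots is `4K` over
their sum. If `T < 8K`, the bound `4 √K` suffices because `√T ≤ 3 √K`; this case fixes the constant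
`12`. -/
theorem volume_slice_le_div (c : ℝ) {h K T : ℝ} (hK : 1 ≤ K) (hT : 0 < T)
    (hTh : T - 4 * K ≤ (h - 4 * K) / 2) :
    volume {x : ℝ | |2 * (x - c) ^ 2 - h| ≤ 4 * K} ≤ ENNReal.ofReal (12 * K / √T) := by
  have hsT : 0 < √T := Real.sqrt_pos.2 hT
  rcases lt_or_ge T (8 * K) with hTK | hTK
  · refine (volume_slice_le_sqrt c h hK).trans (ENNReal.ofReal_le_ofReal ?_)
    rw [le_div_iff₀ hsT]
    have h1 : √T ≤ 3 * √K := by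
      refine Real.sqrt_le_iff.2 ⟨by positivity, ?_⟩
      rw [mul_pow, Real.sq_sqrt (by linarith)]
      linarith
    nlinarith [Real.sq_sqrt (by linarith : 0 ≤ K), Real.sqrt_nonneg K]
  · refine (volume_abs_two_mul_sq_sub_le c h K).trans (ENNReal.ofReal_le_ofReal ?_)
    rw [le_div_iff₀ hsT]
    have hP : T / 2 ≤ (h - 4 * K) / 2 := by linarith
    have ha2 := Real.sq_sqrt (by linarith : 0 ≤ (h - 4 * K) / 2)
    have hb2 := Real.sq_sqrt (by linarith : 0 ≤ (h + 4 * K) / 2)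
    have hab : √((h - 4 * K) / 2) ≤ √((h + 4 * K) / 2) := Real.sqrt_le_sqrt (by linarith)
    have h1 : √T ≤ 2 * √((h - 4 * K) / 2) := by
      refine Real.sqrt_le_iff.2 ⟨by positivity, ?_⟩
      rw [mul_pow, ha2]
      linarith
    nlinarith [Real.sqrt_nonneg ((h - 4 * K) / 2)]

theorem sum_inv_sqrt_le (N : ℕ) : ∑ j ∈ Finset.range N, 1 / √((j : ℝ) + 1) ≤ 2 * √N := by
  induction N with
  | zero => simp
  | succ N ih =>
    rw [Finset.sum_range_succ]
    have h1 : 0 < √((N : ℝ) + 1) := Real.sqrt_pos.2 (by positivity)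
    have h2 := Real.sq_sqrt (by positivity : (0 : ℝ) ≤ (N : ℝ) + 1)
    have h3 := Real.sq_sqrt (by positivity : (0 : ℝ) ≤ (N : ℝ))
    have h4 : 1 / √((N : ℝ) + 1) ≤ 2 * √((N : ℝ) + 1) - 2 * √N := by
      rw [div_le_iff₀ h1]
      nlinarith [sq_nonneg (√((N : ℝ) + 1) - √N)]
    push_cast
    linarith

/-- The `x`-slice at transversal frequency `m` of the elliptic shell. -/
def shellSlice (α K M c : ℝ) (n m : ℤ) : Set ℝ :=
  {x : ℝ | |2 * (x - c) ^ 2 - (M - pairSymbol α n m)| ≤ 4 * K}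

theorem pairSymbol_le_of_volume_ne_zero {α K M c : ℝ} {n m : ℤ}
    (h : volume (shellSlice α K M c n m) ≠ 0) : pairSymbol α n m ≤ M + 4 * K := by
  obtain ⟨x, hx⟩ := nonempty_of_measure_ne_zero h
  rw [shellSlice, Set.mem_ofPred_eq] at hx
  have := (abs_le.1 hx).2
  nlinarith [sq_nonneg (x - c)]

/-- A non-null slice at `m'` forces `M ≥ pairSymbol α n m' - 4K`, so the growth of the symbol from
`m` to `m'` makes `M - pairSymbol α n m` large, whatever `M` is. -/
theorem volume_shellSlice_le_div {α K M c : ℝ} (hα : 1 ≤ α) (hK : 1 ≤ K) {n m m' : ℤ}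
    (h : n ≤ 2 * m) (hm : m < m') (hne : volume (shellSlice α K M c n m') ≠ 0) :
    volume (shellSlice α K M c n m) ≤
      ENNReal.ofReal (12 * K / √(((m' - m : ℤ) : ℝ) * ((m' : ℝ) - n / 2))) := by
  have h1 := pairSymbol_le_of_volume_ne_zero hne
  have h2 := pairSymbol_growth hα h hm.le
  have h' : (n : ℝ) ≤ 2 * m := by exact_mod_cast h
  have hm' : (m : ℝ) < m' := by exact_mod_cast hm
  refine volume_slice_le_div c hK (mul_pos ?_ ?_) ?_
  · push_cast; linarith
  · linarith
  · linarith

theorem tsum_volume_shellSlice_half_le {α K M c : ℝ} (hα : 1 ≤ α) (hK : 1 ≤ K) (n : ℤ) :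
    ∑' m : ℤ, (if n ≤ 2 * m then volume (shellSlice α K M c n m) else 0) ≤
      ENNReal.ofReal (28 * K) := by
  by_cases hex : ∃ m, n ≤ 2 * m ∧ volume (shellSlice α K M c n m) ≠ 0
  swap
  · push Not at hex
    refine le_trans (le_of_eq ?_) zero_le
    rw [ENNReal.tsum_eq_zero]
    intro m
    split_ifs with h
    · exact hex m h
    · rfl
  obtain ⟨m', ⟨hm', hne⟩, hmax⟩ := Int.exists_greatest_of_bdd
    (P := fun m => n ≤ 2 * m ∧ volume (shellSlice α K M c n m) ≠ 0)
    ⟨⌊M + 4 * K + 1⌋, fun m hm => Int.le_floor.2 (by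
      have h1 := pairSymbol_le_of_volume_ne_zero hm.2
      have h2 := le_pairSymbol hα n m
      linarith)⟩ hex
  -- The integer quotient `(n + 1) / 2` is `n / 2` rounded up, the least index of the half-line.
  obtain ⟨J, hJ⟩ : ∃ J : ℕ, (J : ℤ) = m' - (n + 1) / 2 :=
    ⟨(m' - (n + 1) / 2).toNat, Int.toNat_of_nonneg (by omega)⟩
  have hsum : ∑' m : ℤ, (if n ≤ 2 * m then volume (shellSlice α K M c n m) else 0) =
      ∑ j ∈ Finset.range (J + 1), volume (shellSlice α K M c n (m' - j)) := by
    have hinj : Function.Injective fun j : ℕ => m' - (j : ℤ) := fun i j hij => by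
      simp only at hij; omega
    rw [tsum_eq_sum (s := (Finset.range (J + 1)).map ⟨_, hinj⟩), Finset.sum_map]
    · refine Finset.sum_congr rfl fun j hj => ?_
      rw [Finset.mem_range] at hj
      exact if_pos (by simp only [Function.Embedding.coeFn_mk]; omega)
    · intro m hm
      by_contra hne0
      have h1 : n ≤ 2 * m := by
        by_contra h
        exact hne0 (if_neg h)
      rw [if_pos h1] at hne0
      have h2 := hmax m ⟨h1, hne0⟩
      refine hm (Finset.mem_map.2 ⟨(m' - m).toNat, Finset.mem_range.2 (by omega), ?_⟩)
      simp only [Function.Embedding.coeFn_mk]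
      omega
  set L : ℝ := (m' : ℝ) - n / 2 with hL
  have hJL : (J : ℝ) ≤ L := by
    have : (2 * J : ℤ) ≤ 2 * m' - n := by omega
    have : (2 * J : ℝ) ≤ 2 * m' - n := by exact_mod_cast this
    rw [hL]; linarith
  have hterm : ∀ j ∈ Finset.range J, volume (shellSlice α K M c n (m' - ((j + 1 : ℕ) : ℤ))) ≤
      ENNReal.ofReal (12 * K / √L * (1 / √((j : ℝ) + 1))) := fun j hj => by
    rw [Finset.mem_range] at hj
    refine (volume_shellSlice_le_div hα hK (by omega) (by omega) hne).trans_eq ?_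
    congr 1
    have : ((m' - (m' - ((j + 1 : ℕ) : ℤ)) : ℤ) : ℝ) = (j : ℝ) + 1 := by push_cast; ring
    rw [this, Real.sqrt_mul (by positivity), div_mul_div_comm, mul_one, mul_comm (√L)]
  -- The top slice `j = 0` has nothing to be compared with and takes the uniform bound; `28 = 24 +
  -- 4`.
  have h0 : volume (shellSlice α K M c n (m' - ((0 : ℕ) : ℤ))) ≤ ENNReal.ofReal (4 * K) := by
    refine (volume_slice_le_sqrt c _ hK).trans (ENNReal.ofReal_le_ofReal ?_)
    have : √K ≤ K := Real.sqrt_le_iff.2 ⟨by linarith, by nlinarith⟩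
    linarith
  have hreal : ∑ j ∈ Finset.range J, 12 * K / √L * (1 / √((j : ℝ) + 1)) ≤ 24 * K := by
    rw [← Finset.mul_sum]
    rcases (Nat.cast_nonneg J |>.trans hJL).eq_or_lt with h | h
    -- Here `L = 0`, and division by zero makes every term `0`.
    · rw [← h]
      simp only [Real.sqrt_zero, div_zero, zero_mul]
      linarith
    · have hsL := Real.sqrt_pos.2 h
      calc _ ≤ 12 * K / √L * (2 * √L) := by
            gcongr
            refine (sum_inv_sqrt_le J).trans ?_
            gcongr
        _ = 24 * K := by field_simp; ring
  rw [hsum, Finset.sum_range_succ']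
  calc _ ≤ ∑ j ∈ Finset.range J, ENNReal.ofReal (12 * K / √L * (1 / √((j : ℝ) + 1))) +
        ENNReal.ofReal (4 * K) := add_le_add (Finset.sum_le_sum hterm) h0
    _ = ENNReal.ofReal (∑ j ∈ Finset.range J, 12 * K / √L * (1 / √((j : ℝ) + 1)) + 4 * K) := by
        have hnn : ∀ j ∈ Finset.range J, 0 ≤ 12 * K / √L * (1 / √((j : ℝ) + 1)) :=
          fun j _ => by positivity
        rw [← ENNReal.ofReal_sum_of_nonneg hnn,
          ENNReal.ofReal_add (Finset.sum_nonneg hnn) (by linarith)]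
    _ ≤ _ := ENNReal.ofReal_le_ofReal (by linarith)

/-- The reflection `m ↦ n - m` preserves the slices and exchanges the two halves, so the constant
doubles. -/
theorem tsum_volume_shellSlice_le {α K M c : ℝ} (hα : 1 ≤ α) (hK : 1 ≤ K) (n : ℤ) :
    ∑' m : ℤ, volume (shellSlice α K M c n m) ≤ ENNReal.ofReal (56 * K) := by
  set S := fun m : ℤ => if n ≤ 2 * m then volume (shellSlice α K M c n m) else 0 with hS
  have hhalf : ∑' m, S m ≤ ENNReal.ofReal (28 * K) := tsum_volume_shellSlice_half_le hα hK n
  have hsymm : ∀ m, volume (shellSlice α K M c n (n - m)) = volume (shellSlice α K M c n m) :=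
    fun m => by rw [shellSlice, shellSlice, pairSymbol_sub]
  calc ∑' m : ℤ, volume (shellSlice α K M c n m) ≤ ∑' m, (S m + S (n - m)) := by
        refine ENNReal.tsum_le_tsum fun m => ?_
        rcases le_total n (2 * m) with h | h
        · rw [hS]
          simp only [if_pos h]
          exact le_self_add
        · rw [hS]
          simp only [if_pos (show n ≤ 2 * (n - m) by omega), hsymm]
          exact le_add_self
    _ = ∑' m, S m + ∑' m, S m := by
        rw [ENNReal.tsum_add]
        congr 1
        exact (Equiv.subLeft n).tsum_eq S
    _ ≤ _ := by
        refine (add_le_add hhalf hhalf).trans_eq ?_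
        rw [← ENNReal.ofReal_add (by linarith) (by linarith)]
        congr 1
        ring

/-! ### Measure of the frequency intersections and conclusion -/

theorem measurable_abs_intCast_rpow (s : ℝ) : Measurable fun m : ℤ => |(m : ℝ)| ^ s :=
  measurable_from_top

theorem measurableSet_ellipticRegion (α K : ℝ) : MeasurableSet (ellipticRegion α K) := by
  have h : Measurable fun q : Freq => |q.1 + q.2.1 ^ 2 + |(q.2.2 : ℝ)| ^ (2 * α)| := by
    have := (measurable_abs_intCast_rpow (2 * α)).comp (measurable_snd.snd :
      Measurable fun q : Freq => q.2.2)
    have h2 : Measurable fun q : Freq => q.1 + q.2.1 ^ 2 + |(q.2.2 : ℝ)| ^ (2 * α) :=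
      (by fun_prop : Measurable fun q : Freq => q.1 + q.2.1 ^ 2).add this
    exact h2.abs
  exact (measurableSet_le measurable_const h).inter (measurableSet_le h measurable_const)

theorem prod_count_shell_le {α K M c : ℝ} (hα : 1 ≤ α) (hK : 1 ≤ K) (n : ℤ) :
    ((volume : Measure ℝ).prod (Measure.count : Measure ℤ))
      {z | z.1 ∈ shellSlice α K M c n z.2} ≤ ENNReal.ofReal (56 * K) := by
  have hp : Measurable fun z : ℝ × ℤ => pairSymbol α n z.2 :=
    (measurable_from_top : Measurable fun m : ℤ => pairSymbol α n m).comp measurable_snd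
  have hm : MeasurableSet {z : ℝ × ℤ | z.1 ∈ shellSlice α K M c n z.2} :=
    measurableSet_le (f := fun z : ℝ × ℤ => |2 * (z.1 - c) ^ 2 - (M - pairSymbol α n z.2)|)
      (by fun_prop) measurable_const
  rw [Measure.prod_apply_symm hm, lintegral_count]
  exact tsum_volume_shellSlice_le hα hK n

/-- Fubini with `τ'` innermost: the fibre is controlled by the smaller modulation, its base by the
larger, and `224 = 4 * 56`. -/
theorem freqMeasure_ellipticRegion_inter_le {α K₁ K₂ : ℝ} (hα : 1 ≤ α) (hK₁ : 1 ≤ K₁)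
    (hK₂ : 1 ≤ K₂) (q : Freq) :
    freqMeasure {q' | q' ∈ ellipticRegion α K₁ ∧ q - q' ∈ ellipticRegion α K₂} ≤
      ENNReal.ofReal (224 * (K₁ * K₂)) := by
  obtain ⟨τ, ξ, n⟩ := q
  set E : Set (ℝ × ℤ) :=
    {z | z.1 ∈ shellSlice α (max K₁ K₂) (-τ - ξ ^ 2 / 2) (ξ / 2) n z.2} with hE
  have hslice : ∀ z : ℝ × ℤ, volume ((fun t : ℝ => (t, z)) ⁻¹'
      {q' : Freq | q' ∈ ellipticRegion α K₁ ∧ (τ, ξ, n) - q' ∈ ellipticRegion α K₂}) ≤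
      E.indicator (fun _ => ENNReal.ofReal (4 * min K₁ K₂)) z := by
    rintro ⟨x, m⟩
    set a := x ^ 2 + |(m : ℝ)| ^ (2 * α) with ha
    set b := (ξ - x) ^ 2 + |((n - m : ℤ) : ℝ)| ^ (2 * α) with hb
    have hmem : ∀ t : ℝ, t ∈ (fun t : ℝ => (t, ((x, m) : ℝ × ℤ))) ⁻¹'
        {q' : Freq | q' ∈ ellipticRegion α K₁ ∧ (τ, ξ, n) - q' ∈ ellipticRegion α K₂} →
        |t + a| ≤ 2 * K₁ ∧ |τ - t + b| ≤ 2 * K₂ := by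
      intro t ht
      have h1 := ht.1.2
      have h2 := ht.2.2
      simp only [Prod.mk_sub_mk] at h1 h2
      rw [ha, hb, ← add_assoc, ← add_assoc]
      exact ⟨h1, h2⟩
    by_cases hz : (x, m) ∈ E
    · rw [Set.indicator_of_mem hz]
      rcases le_total K₁ K₂ with h | h
      · rw [min_eq_left h]
        refine (measure_mono (t := Set.Icc (-a - 2 * K₁) (-a + 2 * K₁)) fun t ht => ?_).trans_eq
          (by rw [Real.volume_Icc]; congr 1; ring)
        have := abs_le.1 (hmem t ht).1
        exact ⟨by linarith, by linarith⟩
      · rw [min_eq_right h]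
        refine (measure_mono (t := Set.Icc (τ + b - 2 * K₂) (τ + b + 2 * K₂))
          fun t ht => ?_).trans_eq (by rw [Real.volume_Icc]; congr 1; ring)
        have := abs_le.1 (hmem t ht).2
        exact ⟨by linarith, by linarith⟩
    · rw [Set.indicator_of_notMem hz, nonpos_iff_eq_zero]
      refine measure_mono_null (t := ∅) (fun t ht => hz ?_) measure_empty
      obtain ⟨h1, h2⟩ := hmem t ht
      rw [abs_le] at h1 h2
      -- The sum of the two modulations is free of `t`; completing the square in `x² + (ξ - x)²`
      -- gives the shell centred at `ξ / 2`.
      have e : 2 * (x - ξ / 2) ^ 2 - (-τ - ξ ^ 2 / 2 - pairSymbol α n m) =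
          (t + a) + (τ - t + b) := by
        rw [pairSymbol]; ring
      have h3 := le_max_left K₁ K₂
      have h4 := le_max_right K₁ K₂
      change |2 * (x - ξ / 2) ^ 2 - (-τ - ξ ^ 2 / 2 - pairSymbol α n m)| ≤ 4 * max K₁ K₂
      rw [e, abs_le]
      constructor <;> linarith
  have hm : MeasurableSet {q' : Freq | q' ∈ ellipticRegion α K₁ ∧
      (τ, ξ, n) - q' ∈ ellipticRegion α K₂} :=
    (measurableSet_ellipticRegion α K₁).inter
      ((measurable_const.sub measurable_id) (measurableSet_ellipticRegion α K₂))
  have hK := hK₁.trans (le_max_left K₁ K₂)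
  rw [freqMeasure, Measure.prod_apply_symm hm]
  calc _ ≤ ∫⁻ z, E.indicator (fun _ => ENNReal.ofReal (4 * min K₁ K₂)) z
          ∂((volume : Measure ℝ).prod (Measure.count : Measure ℤ)) := lintegral_mono hslice
    _ ≤ ENNReal.ofReal (4 * min K₁ K₂) *
          ((volume : Measure ℝ).prod (Measure.count : Measure ℤ)) E :=
        lintegral_indicator_const_le _ _
    _ ≤ ENNReal.ofReal (4 * min K₁ K₂) * ENNReal.ofReal (56 * max K₁ K₂) := by
        gcongr
        exact prod_count_shell_le hα hK n
    _ = _ := by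
        rw [← ENNReal.ofReal_mul (by positivity)]
        congr 1
        rw [← min_mul_max K₁ K₂]
        ring

end EllipticBilinear

end

theorem proposition3p3 (α : ℝ) (hα : 1 ≤ α) :
    ∃ C : ℝ, 0 < C ∧
      ∀ K₁ K₂ : ℝ, 1 ≤ K₁ → 1 ≤ K₂ →
        ∀ u₁ u₂ : EllipticBilinear.Phys → ℂ,
          MemLp u₁ 2 volume → MemLp u₂ 2 volume →
          EllipticBilinear.FourierSupportedIn u₁ (EllipticBilinear.ellipticRegion α K₁) →
          EllipticBilinear.FourierSupportedIn u₂ (EllipticBilinear.ellipticRegion α K₂) →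
            MemLp (fun p => u₁ p * u₂ p) 2 volume ∧
            eLpNorm (fun p => u₁ p * u₂ p) 2 volume ≤
              ENNReal.ofReal (C * (K₁ * K₂) ^ (1 / 2 : ℝ)) *
                eLpNorm u₁ 2 volume * eLpNorm u₂ 2 volume := by
  refine ⟨224 ^ (1 / 2 : ℝ), by positivity, fun K₁ K₂ hK₁ hK₂ u₁ u₂ hu₁ hu₂ h₁ h₂ => ?_⟩
  have hle := EllipticBilinear.eLpNorm_mul_le_of_freqMeasure_le
    (EllipticBilinear.measurableSet_ellipticRegion α K₁)
    (EllipticBilinear.measurableSet_ellipticRegion α K₂) ENNReal.ofReal_ne_top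
    (EllipticBilinear.freqMeasure_ellipticRegion_inter_le hα hK₁ hK₂) hu₁ hu₂ h₁ h₂
  rw [ENNReal.ofReal_rpow_of_nonneg (by positivity) (by norm_num),
    Real.mul_rpow (by norm_num) (by positivity)] at hle
  exact ⟨⟨hu₁.1.mul hu₂.1, hle.trans_lt (ENNReal.mul_lt_top
    (ENNReal.mul_lt_top ENNReal.ofReal_lt_top hu₁.2) hu₂.2)⟩, hle⟩
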